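/- Consider a simple step-stress life test with two distinct stress levels $x_1\ne x_2$, inspection times $0=IT_0<IT_1<\dots<IT_L=\tau_2$, and stress change from $x_1$ to $x_2$ at an inspection time $\tau_1=IT_k$ with $0<\tau_1<\tau_2$. Let $\boldsymbol a=(a_{0j},a_{1j})_{j=1,\dots,R}\in\mathbb R^{2R}$ and $\theta_{ij}=\exp(a_{0j}+a_{1j}x_i)$ for $i=1,2$, $h^{(1)}_j=0$, $h^{(2)}_j=\tau_1(\theta_{2j}/\theta_{1j}-1)$. Each unit has $R$ independent latent lifetimes $T_1,\dots,T_R$ following the cumulative exposure model with exponential lifetimes: $T_j>0$ has distribution function $F_j(t)=1-\exp(-(t+h_j^{(1)})/\theta_{1j})$ for $0<t<\tau_1$ and $F_j(t)=1-\exp(-(t+h_j^{(2)})/\theta_{2j})$ for $t\ge\tau_1$. One observes only whether $T=\min_j T_j$ exceeds $\tau_2$ or, if not, the interval $(IT_{l-1},IT_l]$ containing $T$ and the cause $j$ with $T=T_j$. The cell probabilities $\boldsymbol p(\boldsymbol a)\in\mathbb R^{LR+1}$ of the resulting multinomial model are $$p_{lj}(\boldsymbol a)=\frac{\theta_{ij}^{-1}}{\sum_{m}\theta_{im}^{-1}}\Big(e^{-\sum_m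 (IT_{l-1}+h_m^{(i)})/\theta_{im}}-e^{-\sum_m (IT_{l}+h_m^{(i)})/\theta_{im}}\Big),\qquad p_0(\boldsymbol a)=e^{-\sum_m(\tau_2+h_m^{(2)})/\theta_{2m}},$$ where $i=1$ if $IT_l\le\tau_1$ and $i=2$ otherwise. For $N$ independent units with true parameter $\boldsymbol a_0$, let $\widehat{\boldsymbol p}$ be the vector of cell counts divided by $N$, and for $\beta\ge 0$ let $$d_\beta(\widehat{\boldsymbol p},\boldsymbol p)=\sum_{c}\Big(p_c^{1+\beta}-\big(1+\tfrac1\beta\big)\widehat p_c\,p_c^{\beta}+\tfrac1\beta\widehat p_c^{\,\beta+1}\Big)\ (\beta>0),\qquad d_0(\widehat{\boldsymbol p},\boldsymbol p)=\sum_c\widehat p_c\log\frac{\widehat p_c}{p_c},$$ the sums being over all $LR+1$ cells, with $0\log 0=0$. Let $\widehat{\boldsymbol a}^\beta$ be the minimum density power divergence estimator: a (measurable) random vector that minimizes $\boldsymbol a\mapsto d_\beta(\widehat{\boldsymbol p},\boldsymbol p(\boldsymbol a))$ over $\mathbb R^{2R}$ whenever a minimizer exists. Then the probability that a minimizer exists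 tends to $1$ as $N\to\infty$, and $$\sqrt N\,(\widehat{\boldsymbol a}^\beta-\boldsymbol a_0)\xrightarrow{\;L\;}\mathcal N\big(\boldsymbol 0,\boldsymbol J_\beta^{-1}\boldsymbol K_\beta\boldsymbol J_\beta^{-1}\big),\qquad \boldsymbol J_\beta=\boldsymbol W^T\boldsymbol D_{\boldsymbol p}^{\beta-1}\boldsymbol W,\quad \boldsymbol K_\beta=\boldsymbol W^T\big(\boldsymbol D_{\boldsymbol p}^{2\beta-1}-\boldsymbol p^{\beta}\boldsymbol p^{\beta T}\big)\boldsymbol W,$$ where $\boldsymbol p=\boldsymbol p(\boldsymbol a_0)$, $\boldsymbol D_{\boldsymbol p}$ is the diagonal matrix with diagonal $\boldsymbol p$, $\boldsymbol p^\beta$ is the entrywise power, and $\boldsymbol W=\partial\boldsymbol p/\partial\boldsymbol a$ is the $(LR+1)\times 2R$ Jacobian matrix of $\boldsymbol p(\boldsymbol a)$ at $\boldsymbol a_0$. In particular $\boldsymbol J_\beta$ is invertible and $\boldsymbol J_\beta^{-1}\boldsymbol K_\beta\boldsymbol J_\beta^{-1}$ is positive semidefinite. -/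

import Mathlib

open MeasureTheory ProbabilityTheory Filter Topology Matrix

noncomputable section

/-- Design of a simple step-stress test with `L` inspection intervals: two distinct stress levels
`x 0`, `x 1` (the stress indices `1, 2` are `0, 1 : Fin 2`), inspection times
`0 = IT 0 < IT 1 < ⋯ < IT L`, and the index `k` of the inspection time at which the stress level
is changed; this change happens strictly between the start and the end of the experiment. -/
structure StepStressDesign (L : ℕ) where
  x : Fin 2 → ℝ
  x_ne : x 0 ≠ x 1
  IT : Fin (L + 1) → ℝ
  IT_zero : IT 0 = 0
  IT_strictMono : StrictMono IT
  k : Fin (L + 1)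
  k_pos : 0 < k
  k_lt : k < Fin.last L

/-- The parameter space `ℝ^{2R}`: `a (j, 0)` is `a_{0j}` and `a (j, 1)` is `a_{1j}`. -/
abbrev StepStressParam (R : ℕ) : Type := EuclideanSpace ℝ (Fin R × Fin 2)

/-- The `L R + 1` cells of the multinomial model: `some (l, j)` is failure in the `l`-th
inspection interval due to cause `j`, and `none` is survival beyond the end of the experiment. -/
abbrev StepStressCell (R L : ℕ) : Type := Option (Fin L × Fin R)

namespace StepStressDesign

variable {R L : ℕ}

/-- Time of stress change. -/
def τ₁ (D : StepStressDesign L) : ℝ := D.IT D.k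

/-- Termination time of the experiment. -/
def τ₂ (D : StepStressDesign L) : ℝ := D.IT (Fin.last L)

/-- Scale parameter of risk `j` under stress level `i`, `θ_{ij} = exp(a_{0j} + a_{1j} x_i)`. -/
def scale (D : StepStressDesign L) (a : StepStressParam R) (i : Fin 2) (j : Fin R) : ℝ :=
  Real.exp (a (j, 0) + a (j, 1) * D.x i)

/-- Shifting times: `h_j^{(1)} = 0` and `h_j^{(2)} = τ₁ (θ_{2j} / θ_{1j} - 1)`. -/
def shift (D : StepStressDesign L) (a : StepStressParam R) (i : Fin 2) (j : Fin R) : ℝ :=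
  if i = 0 then 0 else D.τ₁ * (D.scale a 1 j / D.scale a 0 j - 1)

/-- CDF at constant stress level `i` of the lifetime of risk `j`: exponential with mean `θ_{ij}`. -/
def constStressCDF (D : StepStressDesign L) (a : StepStressParam R) (i : Fin 2) (j : Fin R)
    (t : ℝ) : ℝ :=
  cdf (expMeasure (D.scale a i j)⁻¹) t

/-- CDF of the lifetime of risk `j` in the step-stress test under the cumulative exposure
model. -/
def lifetimeCDF (D : StepStressDesign L) (a : StepStressParam R) (j : Fin R) (t : ℝ) : ℝ :=
  if t < D.τ₁ then D.constStressCDF a 0 j t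
  else D.constStressCDF a 1 j (t + D.shift a 1 j)

theorem scale_pos (D : StepStressDesign L) (a : StepStressParam R) (i : Fin 2) (j : Fin R) :
    0 < D.scale a i j := Real.exp_pos _

theorem τ₁_pos (D : StepStressDesign L) : 0 < D.τ₁ := by
  have h := D.IT_strictMono D.k_pos
  rwa [D.IT_zero] at h

/-- The defining equation of the shifting time: the lifetime CDF is continuous at the time of
stress change. -/
theorem constStressCDF_shift (D : StepStressDesign L) (a : StepStressParam R) (j : Fin R) :
    D.constStressCDF a 0 j D.τ₁ = D.constStressCDF a 1 j (D.τ₁ + D.shift a 1 j) := by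
  have h0 := D.scale_pos a 0 j
  have h1 := D.scale_pos a 1 j
  have ht := D.τ₁_pos
  have e : D.τ₁ + D.shift a 1 j = D.τ₁ * (D.scale a 1 j / D.scale a 0 j) := by
    simp only [shift, one_ne_zero, if_false]; ring
  have hp : 0 ≤ D.τ₁ * (D.scale a 1 j / D.scale a 0 j) := by positivity
  rw [constStressCDF, constStressCDF, cdf_expMeasure_eq (inv_pos.2 h0),
    cdf_expMeasure_eq (inv_pos.2 h1), e, if_pos ht.le, if_pos hp]
  congr 3
  field_simp

/-- The stress level during the `l`-th inspection interval `(IT_{l-1}, IT_l]`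
(for `l : Fin L` this is `(IT l.castSucc, IT l.succ]`). -/
def stage (D : StepStressDesign L) (l : Fin L) : Fin 2 := if l.succ ≤ D.k then 0 else 1

/-- Relative risk due to cause `j` under stress level `i`. -/
def relRisk (D : StepStressDesign L) (a : StepStressParam R) (i : Fin 2) (j : Fin R) : ℝ :=
  (D.scale a i j)⁻¹ / ∑ k, (D.scale a i k)⁻¹

/-- The function `exp(-∑_j (t + h_j^{(i)}) / θ_{ij})`, the probability that a unit survives time
`t` when `t` belongs to the period of stress level `i`. -/
def surv (D : StepStressDesign L) (a : StepStressParam R) (i : Fin 2) (t : ℝ) : ℝ :=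
  Real.exp (-∑ j, (t + D.shift a i j) / D.scale a i j)

/-- The cell probabilities `p(a)` of the multinomial model. -/
def cellProb (D : StepStressDesign L) (a : StepStressParam R) : StepStressCell R L → ℝ
  | some (l, j) => D.relRisk a (D.stage l) j *
      (D.surv a (D.stage l) (D.IT l.castSucc) - D.surv a (D.stage l) (D.IT l.succ))
  | none => D.surv a 1 D.τ₂

/-- A unit whose latent lifetimes are `t 1, …, t R` is observed in the given cell. Its failure time
is `T = min_j t j` and its cause of failure is the `j` attaining the minimum: it falls into the
cell `(l, j)` if `IT_{l-1} < T ≤ IT_l` and the cause is `j`, and survives if `T > τ₂`. -/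
def InCell (D : StepStressDesign L) (t : Fin R → ℝ) : StepStressCell R L → Prop
  | some (l, j) => D.IT l.castSucc < t j ∧ t j ≤ D.IT l.succ ∧ ∀ i, i ≠ j → t j < t i
  | none => ∀ j, D.τ₂ < t j

open Classical in
/-- The number of the first `N` units that are observed in the cell `c`, where `t n j` is the
lifetime of unit `n` attributed to cause `j`. -/
def cellCount (D : StepStressDesign L) (t : ℕ → Fin R → ℝ) (N : ℕ) (c : StepStressCell R L) : ℕ :=
  ((Finset.range N).filter fun n => D.InCell (t n) c).card

/-- The empirical probability vector. -/
def empProb (D : StepStressDesign L) (t : ℕ → Fin R → ℝ) (N : ℕ) (c : StepStressCell R L) : ℝ :=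
  (D.cellCount t N c : ℝ) / N

/-- Jacobian matrix of the cell probabilities: `W_{c, (k, m)} = ∂ p_c / ∂ a_{mk}`. -/
def jacobian (D : StepStressDesign L) (a : StepStressParam R) :
    Matrix (StepStressCell R L) (Fin R × Fin 2) ℝ :=
  fun c s => fderiv ℝ (fun b : StepStressParam R => D.cellProb b c) a (EuclideanSpace.single s 1)

/-- `J_β(a) = Wᵀ D_p^{β-1} W`. -/
def matJ (D : StepStressDesign L) (β : ℝ) (a : StepStressParam R) :
    Matrix (Fin R × Fin 2) (Fin R × Fin 2) ℝ :=
  (D.jacobian a)ᵀ * diagonal (fun c => D.cellProb a c ^ (β - 1)) * D.jacobian a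

/-- `K_β(a) = Wᵀ (D_p^{2β-1} - p^β (p^β)ᵀ) W`. -/
def matK (D : StepStressDesign L) (β : ℝ) (a : StepStressParam R) :
    Matrix (Fin R × Fin 2) (Fin R × Fin 2) ℝ :=
  (D.jacobian a)ᵀ *
    (diagonal (fun c => D.cellProb a c ^ (2 * β - 1)) -
      vecMulVec (fun c => D.cellProb a c ^ β) (fun c => D.cellProb a c ^ β)) *
    D.jacobian a

/-- The asymptotic covariance matrix `J_β⁻¹ K_β J_β⁻¹`. -/
def asympCov (D : StepStressDesign L) (β : ℝ) (a : StepStressParam R) :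
    Matrix (Fin R × Fin 2) (Fin R × Fin 2) ℝ :=
  (D.matJ β a)⁻¹ * D.matK β a * (D.matJ β a)⁻¹

end StepStressDesign

/-- Density power divergence with tuning parameter `β` between two probability vectors; for
`β = 0` it is its continuous limit, the Kullback-Leibler divergence. -/
def densityPowerDiv {ι : Type*} [Fintype ι] (β : ℝ) (q p : ι → ℝ) : ℝ :=
  if β = 0 then ∑ c, q c * Real.log (q c / p c)
  else ∑ c, (p c ^ (1 + β) - (1 + 1 / β) * q c * p c ^ β + 1 / β * q c ^ (β + 1))

/-- `b` minimizes the density power divergence between `q` and the model cell probabilities over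
the whole parameter space. -/
def IsMinDPD {R L : ℕ} (D : StepStressDesign L) (β : ℝ) (q : StepStressCell R L → ℝ)
    (b : StepStressParam R) : Prop :=
  ∀ b' : StepStressParam R,
    densityPowerDiv β q (D.cellProb b) ≤ densityPowerDiv β q (D.cellProb b')

end

/-! The estimator is a minimum-distance estimator in a smooth finite model, so its asymptotics
follow from a deterministic expansion in the empirical vector `q` near `p(a₀)` together with the
central limit theorem for multinomial frequencies.

The model enters through one fact: on the range of the model, each coordinate of `a` is a function
of the cell probabilities that is differentiable at every `p(a)`. The first and last inspection
intervals lie in different stress periods and determine the hazard rates at both levels; the log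
rates are affine in `x i`, and two distinct levels recover intercept and slope. Continuity of this
left inverse keeps minimizers from escaping to infinity (`comap_cellProb_le_nhds`); its derivative
makes the Jacobian injective, hence `J_β` positive definite (`posDef_matJ`).

Since the divergence separates probability vectors, parameters fitting `q` at least as well as `a₀`
tend to `a₀`. This gives existence by compactness and consistency. Linearizing the estimating
equations gives `b - a₀ = J⁻¹ Wᵀ D_p^(β-1) (q - p(a₀)) + o(‖q - p(a₀)‖)`
(`isLittleO_min_densityPowerDiv`).

On the random side, integration over the failure time shows that the cells have law `p(a₀)`
(`pi_inCell`). Chebyshev's inequality gives `√N`-tightness of the frequencies, the linear part is a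
normalized sum of bounded i.i.d. vectors, and a Slutsky argument discards the remainder. -/

/-! ### The divergence separates probability vectors. -/

section DensityPowerDivergence

variable {ι : Type*} [Fintype ι] {β : ℝ}

theorem densityPowerDiv_self {p : ι → ℝ} (hp : ∀ c, 0 < p c) :
    densityPowerDiv β p p = 0 := by
  unfold densityPowerDiv
  split_ifs with h
  · exact Finset.sum_eq_zero fun c _ => by rw [div_self (hp c).ne']; simp
  · refine Finset.sum_eq_zero fun c _ => ?_
    rw [Real.rpow_add (hp c), Real.rpow_add (hp c), Real.rpow_one]
    field_simp
    ring

theorem tendsto_densityPowerDiv_self {p : ι → ℝ} (hp : ∀ c, 0 < p c) :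
    Tendsto (fun q => densityPowerDiv β q p) (𝓝 p) (𝓝 0) := by
  rw [← densityPowerDiv_self (β := β) hp]
  unfold densityPowerDiv
  split_ifs with h
  · refine tendsto_finsetSum _ fun c _ => ?_
    have : ContinuousAt (fun q : ι → ℝ => q c * Real.log (q c / p c)) p := by
      have h1 : ContinuousAt (fun q : ι → ℝ => q c) p := (continuous_apply c).continuousAt
      exact h1.mul ((h1.div_const _).log (div_pos (hp c) (hp c)).ne')
    exact this
  · refine tendsto_finsetSum _ fun c _ => ?_
    have : ContinuousAt (fun q : ι → ℝ => p c ^ (1 + β) - (1 + 1 / β) * q c * p c ^ β +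
        1 / β * q c ^ (β + 1)) p := by
      have h1 : ContinuousAt (fun q : ι → ℝ => q c) p := (continuous_apply c).continuousAt
      exact (continuousAt_const.sub ((continuousAt_const.mul h1).mul continuousAt_const)).add
        (continuousAt_const.mul (h1.rpow_const (Or.inl (hp c).ne')))
    exact this

/-- For `p > 0` this is strict Bernoulli, `(q/p)^(1+β) > 1 + (1+β)(q/p - 1)`, multiplied by
`p^(1+β)/β`. For `β > 0` the divergence is thus nonnegative cell by cell. -/
theorem densityPowerTerm_pos (hβ : 0 < β) {q p : ℝ} (hq : 0 < q) (hp : 0 ≤ p) (hne : p ≠ q) :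
    0 < p ^ (1 + β) - (1 + 1 / β) * q * p ^ β + 1 / β * q ^ (β + 1) := by
  rcases hp.eq_or_lt with rfl | hp
  · rw [Real.zero_rpow (by linarith), Real.zero_rpow hβ.ne']
    have := Real.rpow_pos_of_pos hq (β + 1)
    simp only [mul_zero, sub_zero, zero_add]
    positivity
  · have hb := one_add_mul_self_lt_rpow_one_add (s := q / p - 1) (p := 1 + β)
      (by have := div_pos hq hp; linarith)
      (by rw [sub_ne_zero]; intro h; rw [div_eq_one_iff_eq hp.ne'] at h; exact hne h.symm)
      (by linarith)
    rw [add_sub_cancel, Real.div_rpow hq.le hp.le, lt_div_iff₀ (by positivity)] at hb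
    rw [add_comm β 1]
    have e : p ^ (1 + β) = p * p ^ β := by rw [Real.rpow_add hp, Real.rpow_one]
    have e2 : (1 + (1 + β) * (q / p - 1)) * p ^ (1 + β) =
        (1 + β) * q * p ^ β - β * p ^ (1 + β) := by
      rw [e]; field_simp; ring
    rw [e2] at hb
    have : p ^ (1 + β) - (1 + 1 / β) * q * p ^ β + 1 / β * q ^ (1 + β) =
        1 / β * (q ^ (1 + β) - ((1 + β) * q * p ^ β - β * p ^ (1 + β))) := by
      field_simp; ring
    rw [this]
    exact mul_pos (by positivity) (by linarith)

theorem densityPowerTerm_nonneg (hβ : 0 < β) {q p : ℝ} (hq : 0 < q) (hp : 0 ≤ p) :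
    0 ≤ p ^ (1 + β) - (1 + 1 / β) * q * p ^ β + 1 / β * q ^ (β + 1) := by
  rcases eq_or_ne p q with rfl | hne
  · rw [Real.rpow_add hq, Real.rpow_add hq, Real.rpow_one]
    refine le_of_eq ?_
    field_simp
    ring
  · exact (densityPowerTerm_pos hβ hq hp hne).le

/-- As `p` stays in `[0, 1]`, `q` may be replaced by its limit `q₀` at vanishing cost. Every cluster
point of `p` in this compact interval is then a zero of the limiting term, and `q₀` is the only
zero. -/
theorem tendsto_of_densityPowerTerm {α : Type*} {l : Filter α} {q p : α → ℝ} {q₀ : ℝ}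
    (hβ : 0 < β) (hq₀ : 0 < q₀) (hq : Tendsto q l (𝓝 q₀)) (hp : ∀ x, p x ∈ Set.Icc (0 : ℝ) 1)
    (h : Tendsto (fun x => p x ^ (1 + β) - (1 + 1 / β) * q x * p x ^ β + 1 / β * q x ^ (β + 1))
      l (𝓝 0)) :
    Tendsto p l (𝓝 q₀) := by
  have hb : Tendsto (fun x => (1 + 1 / β) * ((q x - q₀) * p x ^ β)) l (𝓝 0) := by
    have h1 : Tendsto (fun x => q x - q₀) l (𝓝 0) := by
      simpa using hq.sub (tendsto_const_nhds (x := q₀))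
    have h2 : Tendsto (fun x => (q x - q₀) * p x ^ β) l (𝓝 0) := by
      refine squeeze_zero_norm (fun x => ?_) (tendsto_norm_zero.comp h1)
      rw [norm_mul, Real.norm_of_nonneg (Real.rpow_nonneg (hp x).1 _)]
      exact mul_le_of_le_one_right (norm_nonneg _) (Real.rpow_le_one (hp x).1 (hp x).2 hβ.le)
    simpa using h2.const_mul (1 + 1 / β)
  have hc : Tendsto (fun x => 1 / β * (q x ^ (β + 1) - q₀ ^ (β + 1))) l (𝓝 0) := by
    have := ((hq.rpow_const (p := β + 1) (Or.inl hq₀.ne')).sub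
      (tendsto_const_nhds (x := q₀ ^ (β + 1)))).const_mul (1 / β)
    simpa using this
  have hd : Tendsto (fun x => p x ^ (1 + β) - (1 + 1 / β) * q₀ * p x ^ β +
      1 / β * q₀ ^ (β + 1)) l (𝓝 0) := by
    have := (h.add hb).sub hc
    simp only [add_zero, sub_zero] at this
    refine this.congr fun x => ?_
    ring
  have hmap : Set.Icc (0 : ℝ) 1 ∈ map p l := mem_map.2 (univ_mem' hp)
  refine isCompact_Icc.le_nhds_of_unique_clusterPt hmap fun y hy hcl => ?_
  by_contra hne
  set f : ℝ → ℝ := fun y => y ^ (1 + β) - (1 + 1 / β) * q₀ * y ^ β + 1 / β * q₀ ^ (β + 1)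
  have hf : Continuous f := by
    have h1 : Continuous fun y : ℝ => y ^ (1 + β) :=
      continuous_id.rpow_const fun _ => Or.inr (by linarith)
    have h2 : Continuous fun y : ℝ => y ^ β := continuous_id.rpow_const fun _ => Or.inr hβ.le
    exact (h1.sub (continuous_const.mul h2)).add continuous_const
  have h1 : ClusterPt (f y) (map f (map p l)) := hcl.map hf.continuousAt tendsto_map
  have h2 : map f (map p l) ≤ 𝓝 0 := by rw [Filter.map_map]; exact hd
  have h3 : ClusterPt (f y) (𝓝 0) := h1.mono h2
  have h4 : f y = 0 := by
    have : (𝓝 (f y) ⊓ 𝓝 0).NeBot := h3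
    exact eq_of_nhds_neBot this
  exact (densityPowerTerm_pos hβ hq₀ hy.1 hne).ne' h4

/-- Apply `log x ≤ x - 1` to `x = √p/√q`. The summands of the Kullback-Leibler divergence can be
negative; the correction `p - q` makes them nonnegative and sums to zero over probability vectors.
-/
theorem sq_sqrt_sub_sqrt_le_mul_log {q p : ℝ} (hq : 0 < q) (hp : 0 < p) :
    (√q - √p) ^ 2 ≤ q * Real.log (q / p) - q + p := by
  have hsq := Real.sqrt_pos.2 hq
  have hsp := Real.sqrt_pos.2 hp
  have h1 := Real.log_le_sub_one_of_pos (div_pos hsp hsq)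
  have h2 : Real.log (q / p) = -2 * Real.log (√p / √q) := by
    rw [Real.log_div hq.ne' hp.ne', Real.log_div hsp.ne' hsq.ne', Real.log_sqrt hq.le,
      Real.log_sqrt hp.le]
    ring
  have h3 : q * (√p / √q) = √q * √p := by
    rw [mul_div_assoc', div_eq_iff hsq.ne']
    nlinarith [Real.mul_self_sqrt hq.le]
  rw [h2]
  nlinarith [Real.sq_sqrt hq.le, Real.sq_sqrt hp.le, mul_le_mul_of_nonneg_left h1 hq.le]

/-- Probability vectors whose density power divergence from a convergent sequence of probability
vectors is at most that of the (interior) limit have the same limit. -/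
theorem tendsto_of_densityPowerDiv_le {α : Type*} {l : Filter α} {q p : α → ι → ℝ} {p₀ : ι → ℝ}
    (hβ : 0 ≤ β) (hp₀ : ∀ c, 0 < p₀ c) (hq : Tendsto q l (𝓝 p₀))
    (hqs : ∀ᶠ x in l, ∑ c, q x c = 1) (hp : ∀ x c, 0 < p x c) (hps : ∀ x, ∑ c, p x c = 1)
    (hd : ∀ᶠ x in l, densityPowerDiv β (q x) (p x) ≤ densityPowerDiv β (q x) p₀) :
    Tendsto p l (𝓝 p₀) := by
  have hqc : ∀ c, Tendsto (fun x => q x c) l (𝓝 (p₀ c)) := fun c => tendsto_pi_nhds.1 hq c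
  have hqpos : ∀ᶠ x in l, ∀ c, 0 < q x c :=
    eventually_all.2 fun c => (hqc c).eventually (lt_mem_nhds (hp₀ c))
  have hlim : Tendsto (fun x => densityPowerDiv β (q x) p₀) l (𝓝 0) :=
    (tendsto_densityPowerDiv_self hp₀).comp hq
  rw [tendsto_pi_nhds]
  intro c
  rcases hβ.eq_or_lt with rfl | hβ
  · have key : Tendsto (fun x => (√(q x c) - √(p x c)) ^ 2) l (𝓝 0) := by
      refine tendsto_of_tendsto_of_tendsto_of_le_of_le' tendsto_const_nhds hlim
        (Eventually.of_forall fun x => sq_nonneg _) ?_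
      filter_upwards [hqpos, hd, hqs] with x hx hdx hsx
      refine le_trans ?_ hdx
      simp only [densityPowerDiv, if_true]
      calc (√(q x c) - √(p x c)) ^ 2 ≤ ∑ c, (√(q x c) - √(p x c)) ^ 2 :=
            Finset.single_le_sum (f := fun c => (√(q x c) - √(p x c)) ^ 2)
              (fun _ _ => sq_nonneg _) (Finset.mem_univ c)
        _ ≤ ∑ c, (q x c * Real.log (q x c / p x c) - q x c + p x c) :=
            Finset.sum_le_sum fun c _ => sq_sqrt_sub_sqrt_le_mul_log (hx c) (hp x c)
        _ = ∑ c, q x c * Real.log (q x c / p x c) := by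
            rw [Finset.sum_add_distrib, Finset.sum_sub_distrib, hsx, hps]; ring
    have k2 : Tendsto (fun x => √(q x c) - √(p x c)) l (𝓝 0) := by
      have := key.sqrt
      simp only [Real.sqrt_sq_eq_abs, Real.sqrt_zero] at this
      exact (tendsto_zero_iff_abs_tendsto_zero _).2 this
    have k3 : Tendsto (fun x => √(p x c)) l (𝓝 √(p₀ c)) := by
      have := ((hqc c).sqrt).sub k2
      simpa using this
    have := k3.pow 2
    simpa [Real.sq_sqrt (hp _ c).le, Real.sq_sqrt (hp₀ c).le] using this
  · refine tendsto_of_densityPowerTerm hβ (hp₀ c) (hqc c)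
      (fun x => ⟨(hp x c).le, ?_⟩) ?_
    · rw [← hps x]
      exact Finset.single_le_sum (f := p x) (fun c _ => (hp x c).le) (Finset.mem_univ c)
    · refine tendsto_of_tendsto_of_tendsto_of_le_of_le' tendsto_const_nhds hlim ?_ ?_
      · filter_upwards [hqpos] with x hx
        exact densityPowerTerm_nonneg hβ (hx c) (hp x c).le
      · filter_upwards [hqpos, hd] with x hx hdx
        refine le_trans ?_ hdx
        simp only [densityPowerDiv, if_neg hβ.ne']
        exact Finset.single_le_sum
          (f := fun c => p x c ^ (1 + β) - (1 + 1 / β) * q x c * p x c ^ β +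
            1 / β * q x c ^ (β + 1))
          (fun c _ => densityPowerTerm_nonneg hβ (hx c) (hp x c).le) (Finset.mem_univ c)

end DensityPowerDivergence

/-! ### Deterministic theory of minimum divergence estimation in a smooth finite model. -/

section MinimumDivergence

variable {ι κ : Type*} [Fintype ι] {β : ℝ}
  {p : EuclideanSpace ℝ κ → ι → ℝ} {a₀ : EuclideanSpace ℝ κ}

/-- Consistency: parameters fitting `q` at least as well as `a₀` converge to `a₀` as
`q` tends to `p a₀`. -/
theorem tendsto_of_densityPowerDiv_le_true (hβ : 0 ≤ β) (hpos : ∀ a c, 0 < p a c)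
    (hsum : ∀ a, ∑ c, p a c = 1) (hinv : comap p (𝓝 (p a₀)) ≤ 𝓝 a₀) :
    Tendsto Prod.snd (comap Prod.fst (𝓝 (p a₀)) ⊓ 𝓟 {x : (ι → ℝ) × EuclideanSpace ℝ κ |
      ∑ c, x.1 c = 1 ∧ densityPowerDiv β x.1 (p x.2) ≤ densityPowerDiv β x.1 (p a₀)}) (𝓝 a₀) := by
  set l := comap Prod.fst (𝓝 (p a₀)) ⊓ 𝓟 {x : (ι → ℝ) × EuclideanSpace ℝ κ |
      ∑ c, x.1 c = 1 ∧ densityPowerDiv β x.1 (p x.2) ≤ densityPowerDiv β x.1 (p a₀)}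
  have hl : ∀ᶠ x in l, ∑ c, x.1 c = 1 ∧
      densityPowerDiv β x.1 (p x.2) ≤ densityPowerDiv β x.1 (p a₀) :=
    mem_inf_of_right (mem_principal_self _)
  have h : Tendsto (fun x : (ι → ℝ) × EuclideanSpace ℝ κ => p x.2) l (𝓝 (p a₀)) :=
    tendsto_of_densityPowerDiv_le (q := Prod.fst) hβ (hpos a₀) (tendsto_comap.mono_left inf_le_left)
      (hl.mono fun _ h => h.1) (fun _ => hpos _) (fun _ => hsum _) (hl.mono fun _ h => h.2)
  exact (tendsto_comap_iff.2 h).mono_right hinv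

theorem continuous_densityPowerDiv_comp (hpos : ∀ a c, 0 < p a c) (hp : Continuous p)
    (q : ι → ℝ) : Continuous fun a => densityPowerDiv β q (p a) := by
  have hc : ∀ c, Continuous fun a => p a c := fun c => (continuous_apply c).comp hp
  unfold densityPowerDiv
  split_ifs with h
  · refine continuous_finsetSum _ fun c _ => ?_
    by_cases hq : q c = 0
    · simpa [hq] using continuous_const
    · exact continuous_const.mul ((continuous_const.div (hc c) fun a => (hpos a c).ne').log
        fun a => div_ne_zero hq (hpos a c).ne')
  · refine continuous_finsetSum _ fun c _ => ?_
    exact (((hc c).rpow_const fun a => Or.inl (hpos a c).ne').sub (continuous_const.mul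
      ((hc c).rpow_const fun a => Or.inl (hpos a c).ne'))).add continuous_const

variable [Fintype κ]

/-- A minimum density power divergence estimate exists for all probability vectors close to the
true one. -/
theorem eventually_exists_min_densityPowerDiv (hβ : 0 ≤ β) (hpos : ∀ a c, 0 < p a c)
    (hsum : ∀ a, ∑ c, p a c = 1) (hp : Continuous p) (hinv : comap p (𝓝 (p a₀)) ≤ 𝓝 a₀) :
    ∀ᶠ q in 𝓝 (p a₀), ∑ c, q c = 1 →
      ∃ b, ∀ b', densityPowerDiv β q (p b) ≤ densityPowerDiv β q (p b') := by
  -- For `q` near `p a₀`, every competitor at least as good as `a₀` lies in the unit ball, so a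
  -- minimizer over this compact ball is global. The radius 1 is arbitrary.
  have h := (tendsto_of_densityPowerDiv_le_true hβ hpos hsum hinv).eventually
    (Metric.closedBall_mem_nhds a₀ one_pos)
  rw [eventually_inf_principal, eventually_comap] at h
  filter_upwards [h] with q hq hs
  obtain ⟨b, -, hb⟩ := (isCompact_closedBall a₀ 1).exists_isMinOn
    ⟨a₀, Metric.mem_closedBall_self zero_le_one⟩
    (continuous_densityPowerDiv_comp (β := β) hpos hp q).continuousOn
  refine ⟨b, fun b' => ?_⟩
  by_cases hb' : densityPowerDiv β q (p b') ≤ densityPowerDiv β q (p a₀)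
  · exact hb (hq (q, b') rfl ⟨hs, hb'⟩)
  · exact (hb (Metric.mem_closedBall_self zero_le_one)).trans (not_le.1 hb').le

/-- The estimating equations of the minimum density power divergence estimator. -/
theorem sum_jacobian_mul_eq_zero (hpos : ∀ a c, 0 < p a c)
    (hsum : ∀ a, ∑ c, p a c = 1) {q : ι → ℝ} {b : EuclideanSpace ℝ κ}
    (hβ : 0 ≤ β) (hd : ∀ c, DifferentiableAt ℝ (fun a => p a c) b)
    (hb : ∀ b', densityPowerDiv β q (p b) ≤ densityPowerDiv β q (p b')) (v : EuclideanSpace ℝ κ) :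
    ∑ c, fderiv ℝ (fun a => p a c) b v * p b c ^ (β - 1) * (p b c - q c) = 0 := by
  have hmin : IsLocalMin (fun a => densityPowerDiv β q (p a)) b := Eventually.of_forall hb
  -- At `β = 0` the score is `-∑ q_c ∂p_c / p_c`; adding this zero sum brings it to the form with
  -- `p_c - q_c` shared by all `β`.
  have hz : ∑ c, fderiv ℝ (fun a => p a c) b v = 0 := by
    have h1 : HasFDerivAt (fun a => ∑ c, p a c) (∑ c, fderiv ℝ (fun a => p a c) b) b :=
      HasFDerivAt.fun_sum fun c _ => (hd c).hasFDerivAt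
    simp only [hsum] at h1
    have := h1.unique (hasFDerivAt_const (1 : ℝ) b)
    simpa using congrArg (fun L => L v) this
  rcases hβ.eq_or_lt with rfl | hβ
  · have e : (fun a => densityPowerDiv 0 q (p a)) =
        fun a => ∑ c, (q c * Real.log (q c) - q c * Real.log (p a c)) := by
      ext a
      simp only [densityPowerDiv, if_true]
      refine Finset.sum_congr rfl fun c _ => ?_
      by_cases hq : q c = 0
      · simp [hq]
      · rw [Real.log_div hq (hpos a c).ne']; ring
    rw [e] at hmin
    have h1 : HasFDerivAt (fun a => ∑ c, (q c * Real.log (q c) - q c * Real.log (p a c)))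
        (∑ c, (0 - q c • ((p b c)⁻¹ • fderiv ℝ (fun a => p a c) b))) b :=
      HasFDerivAt.fun_sum fun c _ => (hasFDerivAt_const _ b).sub
        (((hd c).hasFDerivAt.log (hpos b c).ne').const_mul (q c))
    have h2 := congrArg (fun L => L v) (hmin.hasFDerivAt_eq_zero h1)
    simp only [FunLike.coe_sum, Finset.sum_apply, zero_sub, FunLike.coe_neg,
      Pi.neg_apply, FunLike.coe_smul, Pi.smul_apply, smul_eq_mul, FunLike.coe_zero,
      Pi.zero_apply] at h2
    refine Eq.trans ?_ ((congrArg₂ (· + ·) h2 hz).trans (add_zero 0))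
    simp only [← Finset.sum_add_distrib]
    refine Finset.sum_congr rfl fun c _ => ?_
    have := (hpos b c).ne'
    rw [zero_sub, Real.rpow_neg_one]
    field_simp
    ring
  · have e : (fun a => densityPowerDiv β q (p a)) = fun a => ∑ c, (p a c ^ (1 + β) -
        (1 + 1 / β) * q c * p a c ^ β + 1 / β * q c ^ (β + 1)) := by
      ext a; simp only [densityPowerDiv, if_neg hβ.ne']
    rw [e] at hmin
    have h1 : HasFDerivAt (fun a => ∑ c, (p a c ^ (1 + β) -
        (1 + 1 / β) * q c * p a c ^ β + 1 / β * q c ^ (β + 1)))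
        (∑ c, (((1 + β) * p b c ^ (1 + β - 1)) • fderiv ℝ (fun a => p a c) b -
          ((1 + 1 / β) * q c) • ((β * p b c ^ (β - 1)) • fderiv ℝ (fun a => p a c) b) )) b :=
      HasFDerivAt.fun_sum fun c _ => (((hd c).hasFDerivAt.rpow_const (Or.inl (hpos b c).ne')).sub
        (((hd c).hasFDerivAt.rpow_const (Or.inl (hpos b c).ne')).const_mul _)).add_const _
    have h2 := congrArg (fun L => L v) (hmin.hasFDerivAt_eq_zero h1)
    simp only [FunLike.coe_sum, Finset.sum_apply, FunLike.coe_sub, Pi.sub_apply,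
      FunLike.coe_smul, Pi.smul_apply, smul_eq_mul, FunLike.coe_zero, Pi.zero_apply] at h2
    have h3 : (1 + β) * ∑ c, fderiv ℝ (fun a => p a c) b v * p b c ^ (β - 1) * (p b c - q c) = 0 := by
      rw [← h2, Finset.mul_sum]
      refine Finset.sum_congr rfl fun c _ => ?_
      have e : p b c ^ (1 + β - 1) = p b c * p b c ^ (β - 1) := by
        rw [show 1 + β - 1 = 1 + (β - 1) by ring, Real.rpow_add (hpos b c), Real.rpow_one]
      rw [e]
      field_simp
      ring
    exact (mul_eq_zero.1 h3).resolve_left (by linarith)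

variable [DecidableEq κ]

/-- The estimator is asymptotically linear in the empirical probability vector. -/
theorem isLittleO_min_densityPowerDiv (hβ : 0 ≤ β) (hpos : ∀ a c, 0 < p a c)
    (hsum : ∀ a, ∑ c, p a c = 1) (hp : ∀ c, ContDiff ℝ 1 fun a => p a c)
    (hinv : comap p (𝓝 (p a₀)) ≤ 𝓝 a₀) {W : EuclideanSpace ℝ κ → Matrix ι κ ℝ}
    (hW : ∀ a c s, W a c s = fderiv ℝ (fun b => p b c) a (EuclideanSpace.single s 1))
    [DecidableEq ι] {B : Matrix κ ι ℝ}
    (hB : B = (W a₀)ᵀ * diagonal fun c => p a₀ c ^ (β - 1)) (hJ : IsUnit (B * W a₀).det) :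
    (fun x : (ι → ℝ) × EuclideanSpace ℝ κ =>
      (x.2 - a₀).ofLp - ((B * W a₀)⁻¹ * B) *ᵥ (x.1 - p a₀)) =o[
      comap Prod.fst (𝓝 (p a₀)) ⊓ 𝓟 {x : (ι → ℝ) × EuclideanSpace ℝ κ | ∑ c, x.1 c = 1 ∧
        ∀ b', densityPowerDiv β x.1 (p x.2) ≤ densityPowerDiv β x.1 (p b')}]
      fun x => x.1 - p a₀ := by
  set l := comap Prod.fst (𝓝 (p a₀)) ⊓ 𝓟 {x : (ι → ℝ) × EuclideanSpace ℝ κ | ∑ c, x.1 c = 1 ∧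
        ∀ b', densityPowerDiv β x.1 (p x.2) ≤ densityPowerDiv β x.1 (p b')} with hl
  have hmem : ∀ᶠ x in l, ∑ c, x.1 c = 1 ∧
        ∀ b', densityPowerDiv β x.1 (p x.2) ≤ densityPowerDiv β x.1 (p b') :=
    mem_inf_of_right (mem_principal_self _)
  have hb : Tendsto Prod.snd l (𝓝 a₀) := by
    refine (tendsto_of_densityPowerDiv_le_true hβ hpos hsum hinv).mono_left ?_
    exact inf_le_inf_left _ (principal_mono.2 fun x hx => ⟨hx.1, hx.2 a₀⟩)
  -- The rate of `x.2 - a₀` is not yet known, so errors are first measured against both increments;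
  -- `h8` removes the second one.
  set r : (ι → ℝ) × EuclideanSpace ℝ κ → ℝ := fun x => ‖x.1 - p a₀‖ + ‖x.2 - a₀‖ with hr
  have hvr : (fun x : (ι → ℝ) × EuclideanSpace ℝ κ => x.2 - a₀) =O[l] r :=
    Asymptotics.IsBigO.of_norm_le fun x => by simp only [hr]; linarith [norm_nonneg (x.1 - p a₀)]
  have hur : (fun x : (ι → ℝ) × EuclideanSpace ℝ κ => x.1 - p a₀) =O[l] r :=
    Asymptotics.IsBigO.of_norm_le fun x => by simp only [hr]; linarith [norm_nonneg (x.2 - a₀)]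
  have hfd : ∀ a c v, fderiv ℝ (fun b => p b c) a v = ∑ s, W a c s * v s := by
    intro a c v
    conv_lhs => rw [← (EuclideanSpace.basisFun κ ℝ).sum_repr v]
    simp [hW, mul_comm]
  have h1 : ∀ c, (fun x : (ι → ℝ) × EuclideanSpace ℝ κ =>
      p x.2 c - p a₀ c - ∑ s, W a₀ c s * (x.2 - a₀) s) =o[l] r := by
    intro c
    have h := (((hp c).differentiable one_ne_zero a₀).hasFDerivAt.isLittleO.comp_tendsto
      hb).trans_isBigO hvr
    refine h.congr_left fun x => ?_
    simp only [Function.comp, hfd]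
  have h2 : ∀ c, (fun x : (ι → ℝ) × EuclideanSpace ℝ κ => p x.2 c - x.1 c) =O[l] r := by
    intro c
    have h3 := (((hp c).differentiable one_ne_zero a₀).hasFDerivAt.isBigO_sub.comp_tendsto
      hb).trans hvr
    have h4 : (fun x : (ι → ℝ) × EuclideanSpace ℝ κ => x.1 c - p a₀ c) =O[l] r :=
      (Asymptotics.isBigO_of_le l fun x => norm_le_pi_norm (x.1 - p a₀) c).trans hur
    refine (h3.sub h4).congr_left fun x => ?_
    simp only [Function.comp]
    ring
  have hA : ∀ c s, Tendsto (fun x : (ι → ℝ) × EuclideanSpace ℝ κ =>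
      W x.2 c s * p x.2 c ^ (β - 1) - B s c) l (𝓝 0) := by
    intro c s
    have hBsc : B s c = W a₀ c s * p a₀ c ^ (β - 1) := by
      rw [hB, mul_diagonal, transpose_apply]
    have hcont : Continuous fun a => W a c s * p a c ^ (β - 1) := by
      simp only [hW]
      exact (((hp c).continuous_fderiv one_ne_zero).clm_apply continuous_const).mul
        ((hp c).continuous.rpow_const fun a => Or.inl (hpos a c).ne')
    have := (hcont.tendsto a₀).comp hb
    rw [← hBsc] at this
    simpa using this.sub (tendsto_const_nhds (x := B s c))
  have h5 : (fun x : (ι → ℝ) × EuclideanSpace ℝ κ =>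
      (B * W a₀) *ᵥ (x.2 - a₀).ofLp - B *ᵥ (x.1 - p a₀)) =o[l] r := by
    rw [Asymptotics.isLittleO_pi]
    intro s
    -- The target is `B(p(b) - q)` minus `B` times the Taylor remainder of `p`. By the estimating
    -- equation, `B` in the first term may be replaced by `B - A(b)`, where `A(b) = W(b)ᵀ
    -- D_{p(b)}^(β-1)` tends to `B`.
    have h6 : (fun x : (ι → ℝ) × EuclideanSpace ℝ κ => - (∑ c,
        (W x.2 c s * p x.2 c ^ (β - 1) - B s c) * (p x.2 c - x.1 c)) - ∑ c,
        B s c * (p x.2 c - p a₀ c - ∑ s, W a₀ c s * (x.2 - a₀) s)) =o[l] r := by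
      refine (Asymptotics.IsLittleO.neg_left (Asymptotics.IsLittleO.fun_sum fun c _ => ?_)).sub
        (Asymptotics.IsLittleO.fun_sum fun c _ => (h1 c).const_mul_left _)
      have := ((Asymptotics.isLittleO_one_iff ℝ).2 (hA c s)).mul_isBigO (h2 c)
      simpa using this
    refine h6.congr' ?_ EventuallyEq.rfl
    filter_upwards [hmem] with x hx
    have hsc := sum_jacobian_mul_eq_zero hpos hsum hβ
      (fun c => (hp c).differentiable one_ne_zero x.2) hx.2 (EuclideanSpace.single s 1)
    simp only [← hW] at hsc
    have e : ((B * W a₀) *ᵥ (x.2 - a₀).ofLp - B *ᵥ (x.1 - p a₀)) s =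
        ∑ c, B s c * (∑ s, W a₀ c s * (x.2 - a₀) s - (x.1 c - p a₀ c)) := by
      rw [← mulVec_mulVec, ← mulVec_sub]
      simp [mulVec, dotProduct]
    rw [e]
    have e2 : -∑ c, (W x.2 c s * p x.2 c ^ (β - 1) - B s c) * (p x.2 c - x.1 c) =
        ∑ c, B s c * (p x.2 c - x.1 c) := by
      simp only [sub_mul _ _ (p _ _ - _), Finset.sum_sub_distrib]
      rw [hsc]; ring
    rw [e2, ← Finset.sum_sub_distrib]
    exact Finset.sum_congr rfl fun c _ => by ring
  have h7 : (fun x : (ι → ℝ) × EuclideanSpace ℝ κ =>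
      (x.2 - a₀).ofLp - ((B * W a₀)⁻¹ * B) *ᵥ (x.1 - p a₀)) =o[l] r := by
    refine (((B * W a₀)⁻¹.mulVecLin.toContinuousLinearMap.isBigO_comp _ l).trans_isLittleO h5).congr_left fun x => ?_
    change (B * W a₀)⁻¹ *ᵥ _ = _
    rw [mulVec_sub, mulVec_mulVec, mulVec_mulVec, nonsing_inv_mul _ hJ, one_mulVec]
  -- `C'` compares the Euclidean with the sup norm. Using `h7` with constant `(2C')⁻¹` gives `‖b -
  -- a₀‖ ≤ r/2 + C' C ‖q - p a₀‖`; absorbing `r/2` on the left yields the factor `2(1 + C' C)`.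
  have h8 : r =O[l] fun x : (ι → ℝ) × EuclideanSpace ℝ κ => x.1 - p a₀ := by
    obtain ⟨C, hC⟩ := (((B * W a₀)⁻¹ * B).mulVecLin.toContinuousLinearMap.isBigO_comp
      (fun x : (ι → ℝ) × EuclideanSpace ℝ κ => x.1 - p a₀) l).bound
    obtain ⟨C', hC'pos, hC'⟩ := ((EuclideanSpace.equiv κ ℝ).symm.toContinuousLinearMap.isBigO_comp
      (fun x : (ι → ℝ) × EuclideanSpace ℝ κ => (x.2 - a₀).ofLp) l).exists_pos
    refine Asymptotics.IsBigO.of_bound (2 * (1 + C' * C)) ?_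
    filter_upwards [hC, hC'.bound, h7.bound (c := (2 * C')⁻¹) (by positivity)] with x h1 h2 h3
    have h4 : ‖x.2 - a₀‖ ≤ C' * ‖(x.2 - a₀).ofLp‖ := h2
    have h5 : ‖(x.2 - a₀).ofLp‖ ≤ ‖(x.2 - a₀).ofLp - ((B * W a₀)⁻¹ * B) *ᵥ (x.1 - p a₀)‖ +
        ‖((B * W a₀)⁻¹ * B) *ᵥ (x.1 - p a₀)‖ := norm_le_norm_sub_add _ _
    have h6 : 0 ≤ r x := by positivity
    rw [Real.norm_of_nonneg h6] at h3 ⊢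
    have h7 : ‖x.2 - a₀‖ ≤ r x / 2 + C' * C * ‖x.1 - p a₀‖ :=
      calc _ ≤ C' * ((2 * C')⁻¹ * r x + C * ‖x.1 - p a₀‖) :=
            h4.trans (mul_le_mul_of_nonneg_left (h5.trans (add_le_add h3 h1)) hC'pos.le)
        _ = _ := by field_simp
    simp only [hr] at h7 ⊢
    linarith
  exact h7.trans_isBigO h8

end MinimumDivergence

/-! ### Cell probabilities: positivity, total mass and smoothness. -/

theorem Fin.sum_castSucc_sub_succ {M : Type*} [AddCommGroup M] {n : ℕ} (f : Fin (n + 1) → M) :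
    ∑ i : Fin n, (f i.castSucc - f i.succ) = f 0 - f (Fin.last n) := by
  rw [Finset.sum_sub_distrib, sub_eq_sub_iff_add_eq_add, ← Fin.sum_univ_castSucc,
    Fin.sum_univ_succ]

namespace StepStressDesign

variable {R L : ℕ} (D : StepStressDesign L) (a : StepStressParam R)

/-- Total hazard rate under stress level `i`. -/
noncomputable def totalRate (i : Fin 2) : ℝ := ∑ j, (D.scale a i j)⁻¹

theorem totalRate_pos (j : Fin R) (i : Fin 2) : 0 < D.totalRate a i :=
  Finset.sum_pos (fun j _ => inv_pos.2 (D.scale_pos a i j)) ⟨j, Finset.mem_univ j⟩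

theorem surv_zero (t : ℝ) : D.surv a 0 t = Real.exp (-(t * D.totalRate a 0)) := by
  simp [surv, shift, totalRate, Finset.mul_sum, div_eq_mul_inv]

/-- The shift makes the cumulative hazard additive: `(t + h_j)/θ_{2j} = τ₁/θ_{1j} + (t -
τ₁)/θ_{2j}`. -/
theorem surv_one (t : ℝ) : D.surv a 1 t =
    Real.exp (-((t - D.τ₁) * D.totalRate a 1 + D.τ₁ * D.totalRate a 0)) := by
  simp only [surv, shift, totalRate, Finset.mul_sum, one_ne_zero, if_false,
    ← Finset.sum_add_distrib]
  congr 2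
  refine Finset.sum_congr rfl fun j _ => ?_
  have h0 := (D.scale_pos a 0 j).ne'
  have h1 := (D.scale_pos a 1 j).ne'
  field_simp
  ring

theorem surv_pos (i : Fin 2) (t : ℝ) : 0 < D.surv a i t := Real.exp_pos _

theorem surv_lt_surv (j : Fin R) (i : Fin 2) {s t : ℝ} (h : s < t) :
    D.surv a i t < D.surv a i s := by
  refine Real.exp_lt_exp.2 (neg_lt_neg (Finset.sum_lt_sum_of_nonempty ⟨j, Finset.mem_univ j⟩
    fun j _ => ?_))
  have := D.scale_pos a i j
  gcongr

theorem surv_zero_τ₁ : D.surv a 0 D.τ₁ = D.surv a 1 D.τ₁ := by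
  rw [surv_zero, surv_one]; simp

theorem sum_relRisk_mul (i : Fin 2) (s t : ℝ) :
    ∑ j, D.relRisk a i j * (D.surv a i s - D.surv a i t) = D.surv a i s - D.surv a i t := by
  -- Without risks the relative risks do not sum to one, but survival is constant and both sides
  -- vanish.
  rcases isEmpty_or_nonempty (Fin R) with h | ⟨⟨j⟩⟩
  · simp [surv]
  · rw [← Finset.sum_mul]
    simp only [relRisk]
    rw [← Finset.sum_div]
    exact (congrArg (· * _) (div_self (D.totalRate_pos a j i).ne')).trans (one_mul _)

theorem cellProb_pos (c : StepStressCell R L) : 0 < D.cellProb a c := by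
  match c with
  | none => exact D.surv_pos a _ _
  | some (l, j) =>
    refine mul_pos (div_pos (inv_pos.2 (D.scale_pos a _ j)) (D.totalRate_pos a j _))
      (sub_pos.2 (D.surv_lt_surv a j _ (D.IT_strictMono ?_)))
    exact Fin.castSucc_lt_succ

theorem sum_cellProb : ∑ c, D.cellProb a c = 1 := by
  set S : Fin (L + 1) → ℝ := fun l => if l ≤ D.k then D.surv a 0 (D.IT l) else D.surv a 1 (D.IT l)
    with hS
  have key : ∀ l : Fin L, ∑ j, D.cellProb a (some (l, j)) = S l.castSucc - S l.succ := by
    intro l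
    simp only [cellProb, sum_relRisk_mul, stage, hS]
    by_cases h : l.succ ≤ D.k
    · rw [if_pos h, if_pos h, if_pos (Fin.castSucc_lt_succ.le.trans h)]
    · rw [if_neg h, if_neg h]
      -- Only the interval that starts at the stress change mixes the two formulas for survival;
      -- continuity at `τ₁` keeps the sum telescoping there.
      by_cases h' : l.castSucc ≤ D.k
      · have : l.castSucc = D.k := le_antisymm h' (by
          rw [not_le] at h; exact Fin.le_castSucc_iff.2 h)
        rw [if_pos h', this]
        have := D.surv_zero_τ₁ a
        rw [τ₁] at this
        rw [this]
      · rw [if_neg h']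
  rw [Fintype.sum_option, Fintype.sum_prod_type]
  simp only [key]
  rw [Fin.sum_castSucc_sub_succ]
  simp only [hS, cellProb]
  rw [if_neg (not_le.2 D.k_lt), if_pos D.k_pos.le, D.IT_zero, surv_zero, τ₂]
  simp

theorem contDiff_cellProb (c : StepStressCell R L) {n : WithTop ℕ∞} :
    ContDiff ℝ n fun a : StepStressParam R => D.cellProb a c := by
  have hs : ∀ i j, ContDiff ℝ n fun a : StepStressParam R => D.scale a i j := by
    intro i j
    unfold scale
    fun_prop
  have hsh : ∀ i j, ContDiff ℝ n fun a : StepStressParam R => D.shift a i j := by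
    intro i j
    unfold shift
    split_ifs
    · exact contDiff_const
    · exact contDiff_const.mul (((hs 1 j).div (hs 0 j)
        fun a => (D.scale_pos a 0 j).ne').sub contDiff_const)
  have hsv : ∀ i t, ContDiff ℝ n fun a : StepStressParam R => D.surv a i t := fun i t =>
    (ContDiff.sum fun j _ => (contDiff_const.add (hsh i j)).div (hs i j)
      fun a => (D.scale_pos a i j).ne').neg.exp
  match c with
  | none => exact hsv 1 _
  | some (l, j) =>
    refine ContDiff.mul ?_ ((hsv _ _).sub (hsv _ _))
    exact ((hs _ j).inv fun a => (D.scale_pos a _ j).ne').div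
      (ContDiff.sum fun j _ => (hs _ j).inv fun a => (D.scale_pos a _ j).ne')
      fun a => (D.totalRate_pos a j _).ne'

/-! ### Recovering the parameter from the cell probabilities. -/

theorem length_pos {L : ℕ} (D : StepStressDesign L) : 0 < L := by
  have := D.k_pos.trans D.k_lt
  exact Fin.val_pos_iff.2 this

/-- The first inspection interval. -/
noncomputable def firstInterval : Fin L := ⟨0, D.length_pos⟩

/-- The last inspection interval. -/
noncomputable def lastInterval : Fin L := ⟨L - 1, Nat.sub_lt D.length_pos one_pos⟩

theorem lastInterval_succ : D.lastInterval.succ = Fin.last L := by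
  have := D.length_pos
  ext; simp [lastInterval]; omega

theorem firstInterval_castSucc : D.firstInterval.castSucc = 0 := by
  ext; simp [firstInterval]

theorem stage_firstInterval : D.stage D.firstInterval = 0 := by
  have := Fin.lt_def.1 D.k_pos
  rw [stage, if_pos]
  rw [Fin.le_def]
  simp [firstInterval] at this ⊢
  omega

theorem stage_lastInterval : D.stage D.lastInterval = 1 := by
  rw [stage, if_neg]
  rw [lastInterval_succ]
  exact not_le.2 D.k_lt

/-- The hazard rate of risk `j` under stress level `i` as a function of the cell probabilities. -/
noncomputable def rateOfCellProb (i : Fin 2) (j : Fin R) (p : StepStressCell R L → ℝ) : ℝ :=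
  -- Total rate times share of cause `j`. The total rate is minus the log of the conditional
  -- probability of surviving the interval, over its length. The first interval starts at 0; the
  -- last is reached with probability `p none` plus the mass of its cells.
  if i = 0 then
    -Real.log (1 - ∑ j, p (some (D.firstInterval, j))) / D.IT D.firstInterval.succ *
      (p (some (D.firstInterval, j)) / ∑ j, p (some (D.firstInterval, j)))
  else
    -Real.log (p none / (p none + ∑ j, p (some (D.lastInterval, j)))) /
      (D.IT D.lastInterval.succ - D.IT D.lastInterval.castSucc) *
      (p (some (D.lastInterval, j)) / ∑ j, p (some (D.lastInterval, j)))

theorem sum_cellProb_firstInterval : ∑ j, D.cellProb a (some (D.firstInterval, j)) =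
    1 - D.surv a 0 (D.IT D.firstInterval.succ) := by
  simp only [cellProb, sum_relRisk_mul, stage_firstInterval, firstInterval_castSucc, IT_zero]
  rw [surv_zero _ _ 0]; simp

theorem sum_cellProb_lastInterval : ∑ j, D.cellProb a (some (D.lastInterval, j)) =
    D.surv a 1 (D.IT D.lastInterval.castSucc) - D.surv a 1 D.τ₂ := by
  simp only [cellProb, sum_relRisk_mul, stage_lastInterval, lastInterval_succ, τ₂]

theorem cellProb_div_sum (l : Fin L) (j : Fin R) :
    D.cellProb a (some (l, j)) / ∑ j, D.cellProb a (some (l, j)) = D.relRisk a (D.stage l) j := by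
  simp only [cellProb, sum_relRisk_mul]
  exact mul_div_cancel_right₀ _ (sub_pos.2 (D.surv_lt_surv a j _
    (D.IT_strictMono Fin.castSucc_lt_succ))).ne'

theorem IT_castSucc_lt_succ (l : Fin L) : D.IT l.castSucc < D.IT l.succ :=
  D.IT_strictMono Fin.castSucc_lt_succ

theorem rateOfCellProb_cellProb (i : Fin 2) (j : Fin R) :
    D.rateOfCellProb i j (D.cellProb a) = (D.scale a i j)⁻¹ := by
  have hr : ∀ i, D.totalRate a i * D.relRisk a i j = (D.scale a i j)⁻¹ := fun i =>
    mul_div_cancel₀ _ (D.totalRate_pos a j i).ne'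
  have h1 := D.IT_castSucc_lt_succ D.firstInterval
  have h2 := D.IT_castSucc_lt_succ D.lastInterval
  rw [firstInterval_castSucc, IT_zero] at h1
  unfold rateOfCellProb
  rw [cellProb_div_sum, cellProb_div_sum, stage_firstInterval, stage_lastInterval,
    sum_cellProb_firstInterval, sum_cellProb_lastInterval, sub_sub_cancel]
  split_ifs with h
  · subst h
    rw [surv_zero, Real.log_exp, neg_neg, mul_div_cancel_left₀ _ h1.ne', hr]
  · obtain rfl : i = 1 := by omega
    simp only [cellProb]
    rw [add_sub_cancel, Real.log_div (D.surv_pos a _ _).ne' (D.surv_pos a _ _).ne', surv_one,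
      surv_one, Real.log_exp, Real.log_exp, τ₂, ← lastInterval_succ]
    rw [← hr]
    congr 1
    rw [div_eq_iff (sub_pos.2 h2).ne']
    ring

theorem differentiableAt_rateOfCellProb (i : Fin 2) (j : Fin R) :
    DifferentiableAt ℝ (D.rateOfCellProb i j) (D.cellProb a) := by
  have hp : ∀ c, DifferentiableAt ℝ (fun p : StepStressCell R L → ℝ => p c) (D.cellProb a) :=
    fun c => differentiableAt_apply c _
  have hs : ∀ l, DifferentiableAt ℝ (fun p : StepStressCell R L → ℝ => ∑ j, p (some (l, j)))
    (D.cellProb a) := fun l => DifferentiableAt.fun_sum fun j _ => hp _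
  have hs' : ∀ l, 0 < ∑ j, D.cellProb a (some (l, j)) := fun l =>
    Finset.sum_pos (fun j _ => D.cellProb_pos a _) ⟨j, Finset.mem_univ j⟩
  unfold rateOfCellProb
  split_ifs with h
  · have h1 := (hs' D.firstInterval).ne'
    have h2 : 1 - ∑ j, D.cellProb a (some (D.firstInterval, j)) ≠ 0 := by
      rw [sum_cellProb_firstInterval, sub_sub_cancel]
      exact (D.surv_pos a _ _).ne'
    simp only [div_eq_mul_inv]
    exact DifferentiableAt.fun_mul ((((differentiableAt_const _).fun_sub (hs _)).log
      h2).fun_neg.mul_const _) ((hp _).fun_mul ((hs _).fun_inv h1))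
  · have h1 := D.cellProb_pos a none
    have h2 := hs' D.lastInterval
    simp only [div_eq_mul_inv]
    exact DifferentiableAt.fun_mul ((((hp _).fun_mul (((hp _).fun_add (hs _)).fun_inv
      (add_pos h1 h2).ne')).log (mul_pos h1 (inv_pos.2 (add_pos h1 h2))).ne').fun_neg.mul_const _)
      ((hp _).fun_mul ((hs _).fun_inv h2.ne'))

/-- The coordinates of the parameter as functions of the cell probabilities. -/
noncomputable def paramOfCellProb (s : Fin R × Fin 2) (p : StepStressCell R L → ℝ) : ℝ :=
  if s.2 = 0 then
    (D.x 0 * Real.log (D.rateOfCellProb 1 s.1 p) - D.x 1 * Real.log (D.rateOfCellProb 0 s.1 p)) /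
      (D.x 1 - D.x 0)
  else (Real.log (D.rateOfCellProb 0 s.1 p) - Real.log (D.rateOfCellProb 1 s.1 p)) /
    (D.x 1 - D.x 0)

/-- The log rates are `-(a_{0j} + a_{1j} x_i)`; this is Cramer's rule for the two levels, solvable
because `x 0 ≠ x 1`. -/
theorem paramOfCellProb_cellProb (s : Fin R × Fin 2) :
    D.paramOfCellProb s (D.cellProb a) = a s := by
  have hx : D.x 1 - D.x 0 ≠ 0 := sub_ne_zero.2 D.x_ne.symm
  obtain ⟨j, m⟩ := s
  unfold paramOfCellProb
  simp only [rateOfCellProb_cellProb, Real.log_inv, scale, Real.log_exp]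
  split_ifs with h
  · subst h
    rw [div_eq_iff hx]; ring
  · obtain rfl : m = 1 := by omega
    rw [div_eq_iff hx]; ring

theorem differentiableAt_paramOfCellProb (s : Fin R × Fin 2) :
    DifferentiableAt ℝ (D.paramOfCellProb s) (D.cellProb a) := by
  have hl : ∀ i, DifferentiableAt ℝ (fun p => Real.log (D.rateOfCellProb i s.1 p))
      (D.cellProb a) := fun i => (D.differentiableAt_rateOfCellProb a i s.1).log (by
    rw [rateOfCellProb_cellProb]; exact (inv_pos.2 (D.scale_pos a _ _)).ne')
  unfold paramOfCellProb
  simp only [div_eq_mul_inv]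
  split_ifs with h
  · exact (DifferentiableAt.fun_sub ((hl 1).const_mul _) ((hl 0).const_mul _)).mul_const _
  · exact (DifferentiableAt.fun_sub (hl 0) (hl 1)).mul_const _

/-- Strong identifiability: the left inverse is continuous at `p(a)`, so `p(b) → p(a)` forces `b →
a`, although the parameter space is not compact. -/
theorem comap_cellProb_le_nhds :
    comap (D.cellProb (R := R)) (𝓝 (D.cellProb a)) ≤ 𝓝 a := by
  have h : Tendsto (fun b : StepStressParam R => b.ofLp) (comap D.cellProb (𝓝 (D.cellProb a)))
      (𝓝 a.ofLp) := by
    rw [tendsto_pi_nhds]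
    intro s
    have := (D.differentiableAt_paramOfCellProb a s).continuousAt.tendsto.comp
      (tendsto_comap (f := D.cellProb (R := R)) (x := 𝓝 (D.cellProb a)))
    rw [paramOfCellProb_cellProb] at this
    exact this.congr fun b => D.paramOfCellProb_cellProb b s
  exact ((PiLp.continuous_toLp 2 _).tendsto a.ofLp).comp h

/-! ### Rank of the Jacobian and the asymptotic covariance. -/

theorem jacobian_mulVec (v : StepStressParam R) (c : StepStressCell R L) :
    (D.jacobian a *ᵥ v.ofLp) c = fderiv ℝ (fun b : StepStressParam R => D.cellProb b c) a v := by
  conv_rhs => rw [← (EuclideanSpace.basisFun _ ℝ).sum_repr v]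
  simp [jacobian, mulVec, dotProduct, mul_comm]

/-- By the chain rule, the derivative of the left inverse at `p(a)` is a left inverse of the
Jacobian. -/
theorem jacobian_mulVec_injective : Function.Injective (D.jacobian a).mulVec := by
  rw [← coe_mulVecLin, injective_iff_map_eq_zero]
  intro v hv
  ext s
  have hp : HasFDerivAt (D.cellProb (R := R))
      (ContinuousLinearMap.pi fun c =>
        fderiv ℝ (fun b : StepStressParam R => D.cellProb b c) a) a :=
    hasFDerivAt_pi.2 fun c =>
      ((D.contDiff_cellProb c (n := 1)).differentiable one_ne_zero a).hasFDerivAt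
  have h1 := (D.differentiableAt_paramOfCellProb a s).hasFDerivAt.comp a hp
  have h2 : HasFDerivAt (fun b : StepStressParam R => b s)
      (EuclideanSpace.proj s : StepStressParam R →L[ℝ] ℝ) a :=
    (EuclideanSpace.proj s : StepStressParam R →L[ℝ] ℝ).hasFDerivAt
  have h3 : (D.paramOfCellProb s ∘ D.cellProb (R := R)) = fun b : StepStressParam R => b s :=
    funext fun b => D.paramOfCellProb_cellProb b s
  rw [h3] at h1
  have h4 := congrArg (fun T => T (WithLp.toLp 2 v)) (h2.unique h1)
  have h5 : (ContinuousLinearMap.pi fun c =>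
      fderiv ℝ (fun b : StepStressParam R => D.cellProb b c) a) (WithLp.toLp 2 v) = 0 := by
    ext c
    have := congrFun hv c
    rw [ContinuousLinearMap.pi_apply, ← jacobian_mulVec]
    exact this
  simpa [h5] using h4

theorem posDef_matJ (β : ℝ) : (D.matJ β a).PosDef := by
  have h : (diagonal fun c => D.cellProb a c ^ (β - 1)).PosDef :=
    PosDef.diagonal fun c => Real.rpow_pos_of_pos (D.cellProb_pos a c) _
  have := h.conjTranspose_mul_mul_same (D.jacobian_mulVec_injective a)
  rwa [conjTranspose_eq_transpose_of_trivial] at this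

/-- The derivative of the estimator with respect to the empirical probability vector. -/
noncomputable def influenceMatrix (β : ℝ) : Matrix (Fin R × Fin 2) (StepStressCell R L) ℝ :=
  (D.matJ β a)⁻¹ * ((D.jacobian a)ᵀ * diagonal fun c => D.cellProb a c ^ (β - 1))

/-- `D_p - p pᵀ` is the covariance of one multinomial draw; conjugating it by `D_p^(β-1)` gives the
middle factor of `K_β`. -/
theorem asympCov_eq (β : ℝ) : D.asympCov β a = D.influenceMatrix a β *
    (diagonal (D.cellProb a) - vecMulVec (D.cellProb a) (D.cellProb a)) *
      (D.influenceMatrix a β)ᵀ := by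
  have hJ : (D.matJ β a)⁻¹ᵀ = (D.matJ β a)⁻¹ := by
    rw [transpose_nonsing_inv]
    congr 1
    have := (D.posDef_matJ a β).isHermitian
    rwa [IsHermitian, conjTranspose_eq_transpose_of_trivial] at this
  have hK : (diagonal fun c => D.cellProb a c ^ (β - 1)) *
      (diagonal (D.cellProb a) - vecMulVec (D.cellProb a) (D.cellProb a)) *
      (diagonal fun c => D.cellProb a c ^ (β - 1)) =
      diagonal (fun c => D.cellProb a c ^ (2 * β - 1)) -
      vecMulVec (fun c => D.cellProb a c ^ β) (fun c => D.cellProb a c ^ β) := by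
    have e : ∀ c, D.cellProb a c ^ (β - 1) * D.cellProb a c = D.cellProb a c ^ β := by
      intro c
      rw [← Real.rpow_add_one (D.cellProb_pos a c).ne', sub_add_cancel]
    rw [Matrix.mul_sub, Matrix.sub_mul, diagonal_mul_diagonal, diagonal_mul_diagonal]
    congr 1
    · congr 1; ext c
      rw [e, ← Real.rpow_add (D.cellProb_pos a c)]; congr 1; ring
    · ext c c'
      rw [mul_diagonal, diagonal_mul, vecMulVec_apply, vecMulVec_apply, ← e c, ← e c']
      ring
  rw [asympCov, matK, influenceMatrix, ← hK, transpose_mul, transpose_mul, transpose_transpose,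
    diagonal_transpose, hJ]
  simp only [Matrix.mul_assoc]

/-- The quadratic form is the variance of `g(c)` for a random cell `c` of law `p(a)`, with `g = t ᵥ*
M` and `M` the influence matrix. This gives semidefiniteness and the limiting variance. -/
theorem dotProduct_asympCov_mulVec (β : ℝ) (t : Fin R × Fin 2 → ℝ) :
    t ⬝ᵥ D.asympCov β a *ᵥ t =
      ∑ c, D.cellProb a c * (t ᵥ* D.influenceMatrix a β) c ^ 2 -
        (∑ c, D.cellProb a c * (t ᵥ* D.influenceMatrix a β) c) ^ 2 := by
  rw [asympCov_eq, ← mulVec_mulVec, mulVec_transpose, ← mulVec_mulVec, dotProduct_mulVec]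
  set g := t ᵥ* D.influenceMatrix a β
  rw [Matrix.sub_mulVec, dotProduct_sub, vecMulVec_mulVec]
  congr 1
  · simp only [dotProduct, mulVec_diagonal]
    exact Finset.sum_congr rfl fun c _ => by ring
  · rw [dotProduct_smul, dotProduct_comm g, op_smul_eq_mul, sq]
    rfl

theorem posSemidef_asympCov (β : ℝ) : (D.asympCov β a).PosSemidef := by
  refine PosSemidef.of_dotProduct_mulVec_nonneg ?_ fun t => ?_
  · rw [IsHermitian, conjTranspose_eq_transpose_of_trivial, asympCov_eq]
    simp [Matrix.mul_assoc]
  · rw [star_trivial, dotProduct_asympCov_mulVec]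
    set g := t ᵥ* D.influenceMatrix a β
    set m := ∑ c, D.cellProb a c * g c
    have h : 0 ≤ ∑ c, D.cellProb a c * (g c - m) ^ 2 :=
      Finset.sum_nonneg fun c _ => mul_nonneg (D.cellProb_pos a c).le (sq_nonneg _)
    have e : ∑ c, D.cellProb a c * (g c - m) ^ 2 = ∑ c, D.cellProb a c * g c ^ 2 -
        2 * m * ∑ c, D.cellProb a c * g c + m ^ 2 * ∑ c, D.cellProb a c := by
      rw [Finset.mul_sum _ _ (2 * m), Finset.mul_sum _ _ (m ^ 2), ← Finset.sum_sub_distrib,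
        ← Finset.sum_add_distrib]
      exact Finset.sum_congr rfl fun c _ => by ring
    rw [e, sum_cellProb] at h
    change 0 ≤ _ - m ^ 2
    change 0 ≤ _ - 2 * m * m + _ at h
    linarith

end StepStressDesign

/-! ### Competing independent lifetimes with constant hazards on an interval. -/

section CompetingExponentials

open scoped ENNReal

theorem setLIntegral_mul_exp_neg_Ioc {r q c s t : ℝ} (hr : 0 ≤ r) (hq : 0 < q) (hst : s ≤ t) :
    ∫⁻ u in Set.Ioc s t, ENNReal.ofReal (r * Real.exp (-(c + q * u))) =
      ENNReal.ofReal (r / q * (Real.exp (-(c + q * s)) - Real.exp (-(c + q * t)))) := by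
  have hc : Continuous fun u => r * Real.exp (-(c + q * u)) := by fun_prop
  rw [← ofReal_integral_eq_lintegral_ofReal (hc.integrableOn_Ioc)
    (Eventually.of_forall fun u => mul_nonneg hr (Real.exp_pos _).le),
    ← intervalIntegral.integral_of_le hst]
  congr 1
  have hd : ∀ u ∈ Set.uIcc s t, HasDerivAt (fun u => -(r / q) * Real.exp (-(c + q * u)))
      (r * Real.exp (-(c + q * u))) u := by
    intro u _
    have h1 : HasDerivAt (fun u : ℝ => -(c + q * u)) (-(q * 1)) u :=
      (((hasDerivAt_id u).const_mul q).const_add c).neg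
    exact (h1.exp.const_mul (-(r / q))).congr_deriv (by field_simp)
  rw [intervalIntegral.integral_eq_sub_of_hasDerivAt hd (hc.intervalIntegrable _ _)]
  ring

theorem measureReal_Ioc_of_Ioi {μ : Measure ℝ} [IsFiniteMeasure μ] {s t : ℝ} (hst : s ≤ t) :
    μ.real (Set.Ioc s t) = μ.real (Set.Ioi s) - μ.real (Set.Ioi t) := by
  rw [← Set.Ioi_sdiff_Ioi, measureReal_sdiff (Set.Ioi_subset_Ioi hst) measurableSet_Ioi]

/-- A local statement is needed because the hazard rate changes at `τ₁`; survival on `[s, t]`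
already fixes the mass of each subinterval `(s, v]`. -/
theorem restrict_Ioc_eq_withDensity_exp {μ : Measure ℝ} [IsFiniteMeasure μ] {q c s t : ℝ}
    (hq : 0 < q) (h : ∀ u ∈ Set.Icc s t, μ.real (Set.Ioi u) = Real.exp (-(c + q * u))) :
    μ.restrict (Set.Ioc s t) = (volume.withDensity fun u =>
      ENNReal.ofReal (q * Real.exp (-(c + q * u)))).restrict (Set.Ioc s t) := by
  refine Measure.ext_of_Iic _ _ fun v => ?_
  rw [Measure.restrict_apply measurableSet_Iic, Measure.restrict_apply measurableSet_Iic,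
    Set.inter_comm, Set.Ioc_inter_Iic]
  rcases lt_or_ge (min t v) s with hv | hv
  · rw [Set.Ioc_eq_empty (not_lt.2 hv.le)]; simp
  · rw [withDensity_apply _ measurableSet_Ioc, setLIntegral_mul_exp_neg_Ioc hq.le hq hv,
      div_self hq.ne', one_mul, ← h s ⟨le_rfl, hv.trans (min_le_left _ _)⟩,
      ← h _ ⟨hv, min_le_left _ _⟩, ← measureReal_Ioc_of_Ioi hv, ofReal_measureReal]

/-- Among independent lifetimes with constant hazard rates on `[s, t]`, the probability that the
`j`-th one is the smallest and falls into `(s, t]`. -/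
theorem pi_minimum_mem_Ioc {R : ℕ} (μ : Fin R → Measure ℝ) [∀ i, IsProbabilityMeasure (μ i)]
    {q c : Fin R → ℝ} {s t : ℝ} (hq : ∀ i, 0 < q i) (hst : s ≤ t)
    (h : ∀ i, ∀ u ∈ Set.Icc s t, (μ i).real (Set.Ioi u) = Real.exp (-(c i + q i * u)))
    (j : Fin R) :
    Measure.pi μ {x | s < x j ∧ x j ≤ t ∧ ∀ i, i ≠ j → x j < x i} =
      ENNReal.ofReal (q j / (∑ i, q i) * (Real.exp (-∑ i, (c i + q i * s)) -
        Real.exp (-∑ i, (c i + q i * t)))) := by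
  obtain ⟨n, rfl⟩ : ∃ n, R = n + 1 := ⟨R - 1, by have := j.pos; omega⟩
  -- Fubini after splitting off coordinate `j`: the section at `u ∈ (s, t]` is a product of
  -- half-lines `(u, ∞)`, leaving the integral of `q_j exp(-∑ (c_i + q_i u))`.
  set A : Set (ℝ × (Fin n → ℝ)) := {z | z.1 ∈ Set.Ioc s t} ∩ ⋂ i, {z | z.1 < z.2 i} with hA
  have hAm : MeasurableSet A := by
    refine (measurable_fst measurableSet_Ioc).inter (MeasurableSet.iInter fun i => ?_)
    exact measurableSet_lt measurable_fst ((measurable_pi_apply i).comp measurable_snd)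
  have hmp := measurePreserving_piFinSuccAbove (fun i => μ i) j
  have hpre : {x : Fin (n + 1) → ℝ | s < x j ∧ x j ≤ t ∧ ∀ i, i ≠ j → x j < x i} =
      MeasurableEquiv.piFinSuccAbove (fun _ => ℝ) j ⁻¹' A := by
    ext x
    simp only [hA, Set.mem_ofPred_eq, Set.mem_preimage, Set.mem_inter_iff, Set.mem_iInter,
      Set.mem_Ioc, MeasurableEquiv.piFinSuccAbove_apply, Fin.insertNthEquiv_symm_apply,
      and_assoc, Fin.removeNth]
    refine and_congr_right fun _ => and_congr_right fun _ =>
      ⟨fun h i => h _ (Fin.succAbove_ne j i), fun h i hi => ?_⟩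
    obtain ⟨k, rfl⟩ := Fin.exists_succAbove_eq hi
    exact h k
  rw [hpre, hmp.measure_preimage hAm.nullMeasurableSet, Measure.prod_apply hAm]
  have hsec : ∀ u, Measure.pi (fun i => μ (j.succAbove i)) (Prod.mk u ⁻¹' A) =
      (Set.Ioc s t).indicator (fun u => ∏ i, μ (j.succAbove i) (Set.Ioi u)) u := by
    intro u
    by_cases hu : u ∈ Set.Ioc s t
    · rw [Set.indicator_of_mem hu, ← Measure.pi_pi]
      congr 1
      ext y
      simp [hA, hu.1, hu.2]
    · rw [Set.indicator_of_notMem hu]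
      convert measure_empty (μ := Measure.pi fun i => μ (j.succAbove i))
      ext y
      simp only [hA, Set.mem_preimage, Set.mem_inter_iff, Set.mem_ofPred_eq, Set.mem_empty_iff_false,
        iff_false]
      exact fun h => hu h.1
  simp only [hsec]
  rw [lintegral_indicator measurableSet_Ioc]
  have hcongr : ∀ u ∈ Set.Ioc s t, ∏ i, μ (j.succAbove i) (Set.Ioi u) =
      ENNReal.ofReal (Real.exp (-∑ i, (c (j.succAbove i) + q (j.succAbove i) * u))) := by
    intro u hu
    rw [← Finset.sum_neg_distrib, Real.exp_sum,
      ENNReal.ofReal_prod_of_nonneg fun _ _ => (Real.exp_pos _).le]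
    refine Finset.prod_congr rfl fun i _ => ?_
    rw [← h _ u ⟨hu.1.le, hu.2⟩, ofReal_measureReal]
  rw [setLIntegral_congr_fun measurableSet_Ioc hcongr, restrict_Ioc_eq_withDensity_exp (hq j) (h j),
    setLIntegral_withDensity_eq_setLIntegral_mul _ (by fun_prop) (by fun_prop) measurableSet_Ioc]
  have hQ : 0 < ∑ i, q i := Finset.sum_pos (fun i _ => hq i) ⟨j, Finset.mem_univ j⟩
  have hsum : ∀ u, ∑ i, (c i + q i * u) = ∑ i, c i + (∑ i, q i) * u := fun u => by
    rw [Finset.sum_add_distrib, Finset.sum_mul]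
  rw [hsum, hsum, ← setLIntegral_mul_exp_neg_Ioc (hq j).le hQ hst]
  refine lintegral_congr fun u => ?_
  rw [Pi.mul_apply, ← ENNReal.ofReal_mul (mul_nonneg (hq j).le (Real.exp_pos _).le), mul_assoc,
    ← Real.exp_add, ← hsum, Fin.sum_univ_succAbove _ j]
  congr 3
  ring

end CompetingExponentials

/-! ### Law of the observed cell. -/

namespace StepStressDesign

variable {R L : ℕ} (D : StepStressDesign L) (a : StepStressParam R)

theorem one_sub_lifetimeCDF_of_le {u : ℝ} (h0 : 0 ≤ u) (hu : u ≤ D.τ₁) (j : Fin R) :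
    1 - D.lifetimeCDF a j u = Real.exp (-((u + D.shift a 0 j) / D.scale a 0 j)) := by
  have h : D.lifetimeCDF a j u = D.constStressCDF a 0 j u := by
    rw [lifetimeCDF]
    split_ifs with h
    · rfl
    · obtain rfl : u = D.τ₁ := le_antisymm hu (not_lt.1 h)
      exact (D.constStressCDF_shift a j).symm
  rw [h, constStressCDF, cdf_expMeasure_eq (inv_pos.2 (D.scale_pos a 0 j)), if_pos h0]
  simp [shift, div_eq_inv_mul]

theorem one_sub_lifetimeCDF_of_ge {u : ℝ} (hu : D.τ₁ ≤ u) (j : Fin R) :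
    1 - D.lifetimeCDF a j u = Real.exp (-((u + D.shift a 1 j) / D.scale a 1 j)) := by
  have h0 := D.scale_pos a 0 j
  have h1 := D.scale_pos a 1 j
  have ht := D.τ₁_pos
  have hp : 0 ≤ D.τ₁ * (D.scale a 1 j / D.scale a 0 j) := by positivity
  have h : 0 ≤ u + D.shift a 1 j := by
    simp only [shift, one_ne_zero, if_false]; linarith
  rw [lifetimeCDF, if_neg (not_lt.2 hu), constStressCDF, cdf_expMeasure_eq (inv_pos.2 h1),
    if_pos h]
  simp [div_eq_inv_mul]

theorem one_sub_lifetimeCDF (l : Fin L) {u : ℝ}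
    (hu : u ∈ Set.Icc (D.IT l.castSucc) (D.IT l.succ)) (j : Fin R) :
    1 - D.lifetimeCDF a j u =
      Real.exp (-((u + D.shift a (D.stage l) j) / D.scale a (D.stage l) j)) := by
  unfold stage
  split_ifs with h
  · refine D.one_sub_lifetimeCDF_of_le a ?_ (hu.2.trans (D.IT_strictMono.monotone h)) j
    rw [← D.IT_zero]
    exact (D.IT_strictMono.monotone (Fin.zero_le _)).trans hu.1
  · refine D.one_sub_lifetimeCDF_of_ge a (le_trans (D.IT_strictMono.monotone ?_) hu.1) j
    exact Fin.le_castSucc_iff.2 (not_le.1 h)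

theorem InCell.unique {D : StepStressDesign L} {t : Fin R → ℝ} {c c' : StepStressCell R L}
    (h : D.InCell t c) (h' : D.InCell t c') : c = c' := by
  have key : ∀ {l l' : Fin L} {u : ℝ}, D.IT l.castSucc < u → u ≤ D.IT l'.succ → l ≤ l' := by
    intro l l' u h1 h2
    have := D.IT_strictMono.lt_iff_lt.1 (h1.trans_le h2)
    exact Fin.castSucc_lt_succ_iff.1 this
  match c, c', h, h' with
  | none, none, _, _ => rfl
  | none, some (l, j), h, h' =>
    exact absurd ((h j).trans_le (h'.2.1.trans (D.IT_strictMono.monotone (Fin.le_last _))))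
      (lt_irrefl _)
  | some (l, j), none, h', h =>
    exact absurd ((h j).trans_le (h'.2.1.trans (D.IT_strictMono.monotone (Fin.le_last _))))
      (lt_irrefl _)
  | some (l, j), some (l', j'), h, h' =>
    obtain rfl : j = j' := by
      by_contra hne
      exact lt_asymm (h.2.2 j' (Ne.symm hne)) (h'.2.2 j hne)
    rw [le_antisymm (key h.1 h'.2.1) (key h'.1 h.2.1)]

theorem measurableSet_inCell (c : StepStressCell R L) :
    MeasurableSet {t : Fin R → ℝ | D.InCell t c} := by
  match c with
  | none =>
    simp only [InCell, Set.ofPred_forall]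
    exact MeasurableSet.iInter fun j => measurableSet_lt measurable_const (measurable_pi_apply j)
  | some (l, j) =>
    simp only [InCell, Set.ofPred_and, Set.ofPred_forall]
    refine (measurableSet_lt measurable_const (measurable_pi_apply j)).inter
      ((measurableSet_le (measurable_pi_apply j) measurable_const).inter ?_)
    exact MeasurableSet.iInter fun i => MeasurableSet.iInter fun _ =>
      measurableSet_lt (measurable_pi_apply j) (measurable_pi_apply i)

variable {μ : Fin R → Measure ℝ} [∀ j, IsProbabilityMeasure (μ j)]

/-- The distribution of the cell in which a unit is observed. -/
theorem pi_inCell (hμ : ∀ j t, (μ j).real (Set.Iic t) = D.lifetimeCDF a j t)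
    (c : StepStressCell R L) :
    (Measure.pi μ).real {t | D.InCell t c} = D.cellProb a c := by
  have hIoi : ∀ j t, (μ j).real (Set.Ioi t) = 1 - D.lifetimeCDF a j t := by
    intro j t
    rw [← hμ, ← Set.compl_Iic, probReal_compl_eq_one_sub measurableSet_Iic]
  match c with
  | none =>
    have e : {t : Fin R → ℝ | D.InCell t none} = Set.univ.pi fun _ => Set.Ioi D.τ₂ := by
      ext t; simp [InCell]
    rw [e, measureReal_def, Measure.pi_pi, ENNReal.toReal_prod]
    simp only [cellProb, surv, ← Finset.sum_neg_distrib, Real.exp_sum]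
    refine Finset.prod_congr rfl fun j _ => ?_
    rw [← measureReal_def, hIoi]
    exact D.one_sub_lifetimeCDF_of_ge a (D.IT_strictMono.monotone (Fin.le_last _)) j
  | some (l, j) =>
    have hu : ∀ i u, (u + D.shift a (D.stage l) i) / D.scale a (D.stage l) i =
        D.shift a (D.stage l) i / D.scale a (D.stage l) i + (D.scale a (D.stage l) i)⁻¹ * u := by
      intro i u
      rw [add_div, add_comm, div_eq_inv_mul u]
    have key := pi_minimum_mem_Ioc μ (q := fun i => (D.scale a (D.stage l) i)⁻¹)
      (c := fun i => D.shift a (D.stage l) i / D.scale a (D.stage l) i)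
      (fun i => inv_pos.2 (D.scale_pos a _ i)) (D.IT_castSucc_lt_succ l).le
      (fun i u hiu => by rw [hIoi, D.one_sub_lifetimeCDF a l hiu, hu]) j
    simp only [← hu] at key
    have e : ENNReal.ofReal (D.cellProb a (some (l, j))) =
      Measure.pi μ {t | D.InCell t (some (l, j))} := key.symm
    rw [measureReal_def, ← e, ENNReal.toReal_ofReal (D.cellProb_pos a _).le]

/-- The cells are disjoint and their probabilities sum to one, so ties and nonpositive minima are
negligible without a separate argument. -/
theorem ae_exists_inCell (hμ : ∀ j t, (μ j).real (Set.Iic t) = D.lifetimeCDF a j t) :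
    ∀ᵐ t ∂Measure.pi μ, ∃ c, D.InCell t c := by
  have h : (Measure.pi μ).real (⋃ c : StepStressCell R L, {t | D.InCell t c}) = 1 := by
    have hd : Pairwise (Function.onFun Disjoint
        fun c : StepStressCell R L => {t : Fin R → ℝ | D.InCell t c}) :=
      fun c c' hne => Set.disjoint_left.2 fun t (h : D.InCell t c) (h' : D.InCell t c') =>
        hne (h.unique h')
    rw [measureReal_iUnion_fintype hd fun c => D.measurableSet_inCell c]
    simp only [D.pi_inCell a hμ, sum_cellProb]
  have h' : Measure.pi μ (⋃ c : StepStressCell R L, {t | D.InCell t c}) = 1 := by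
    rw [← ofReal_measureReal, h, ENNReal.ofReal_one]
  have := (mem_ae_iff_prob_eq_one (MeasurableSet.iUnion fun c => D.measurableSet_inCell c)).2 h'
  filter_upwards [this] with t ht
  simpa using ht

end StepStressDesign

/-! ### Multivariate central limit theorem and control of remainders. -/

section VectorCentralLimit

open scoped RealInnerProductSpace

variable {Ω : Type*} [MeasurableSpace Ω] {P : Measure Ω}

theorem ProbabilityTheory.iIndepFun.curry {ι κ E : Type*} [Fintype κ] [MeasurableSpace E]
    [IsProbabilityMeasure P] {X : ι → κ → Ω → E} (hX : ∀ i j, Measurable (X i j))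
    (h : iIndepFun (fun s : ι × κ => X s.1 s.2) P) : iIndepFun (fun i ω j => X i j ω) P := by
  have : ∀ i j, IsProbabilityMeasure (P.map (X i j)) :=
    fun i j => Measure.isProbabilityMeasure_map (hX i j).aemeasurable
  rw [iIndepFun_iff_map_fun_eq_infinitePi_map (by fun_prop)]
  have h1 := (iIndepFun_iff_map_fun_eq_infinitePi_map (by fun_prop)).1 h
  have h2 := Measure.infinitePi_map_curry fun i j => P.map (X i j)
  rw [← h1, Measure.map_map (by fun_prop) (by fun_prop)] at h2
  refine Eq.trans h2 ?_
  congr with i : 1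
  rw [Measure.infinitePi_eq_pi]
  have hi : iIndepFun (X i) P := h.precomp (g := fun j => (i, j)) (Prod.mk_right_injective i)
  exact (hi.map_fun_eq_pi_map fun j => (hX i j).aemeasurable).symm

variable [IsProbabilityMeasure P] {κ : Type*} [Fintype κ] [DecidableEq κ]

/-- The multivariate central limit theorem for centered random vectors. -/
theorem tendstoInDistribution_multivariateGaussian {X : ℕ → Ω → EuclideanSpace ℝ κ}
    (hm : ∀ n, Measurable (X n)) (hindep : iIndepFun X P)
    (hident : ∀ n, IdentDistrib (X n) (X 0) P P) (hX : MemLp (X 0) 2 P)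
    {S : Matrix κ κ ℝ} (hS : S.PosSemidef) (hmean : ∀ t, P[fun ω => ⟪t, X 0 ω⟫] = 0)
    (hvar : ∀ t, Var[fun ω => ⟪t, X 0 ω⟫; P] = t.ofLp ⬝ᵥ S *ᵥ t.ofLp) :
    TendstoInDistribution (fun (n : ℕ) ω => (√n)⁻¹ • ∑ k ∈ Finset.range n, X k ω) atTop
      (id : EuclideanSpace ℝ κ → EuclideanSpace ℝ κ) (fun _ => P) (multivariateGaussian 0 S) where
  forall_aemeasurable n := by fun_prop
  tendsto := by
    refine ProbabilityMeasure.tendsto_iff_tendsto_charFun.2 fun t => ?_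
    -- Cramér-Wold: the characteristic function at `t` is that of the projection `⟪t, ·⟫` at 1.
    have hclt := tendstoInDistribution_inv_sqrt_mul_sum_sub (P := P)
      (X := fun n ω => ⟪t, X n ω⟫) HasLaw.id (hX.const_inner t)
      (hindep.comp (fun _ x => ⟪t, x⟫) fun _ => by fun_prop)
      (fun n => (hident n).comp (u := fun x => ⟪t, x⟫) (by fun_prop))
    have h1 := ProbabilityMeasure.tendsto_iff_tendsto_charFun.1 hclt.tendsto 1
    simp only [ProbabilityMeasure.coe_mk, Measure.map_id, hmean, mul_zero, sub_zero,
      charFun_gaussianReal, hvar] at h1 ⊢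
    rw [charFun_multivariateGaussian hS]
    have h0 : 0 ≤ t.ofLp ⬝ᵥ S *ᵥ t.ofLp := by
      rw [← hvar]; exact variance_nonneg _ _
    convert h1 using 2 with n
    · rw [charFun_apply, charFun_apply, integral_map (by fun_prop) (by fun_prop),
        integral_map (by fun_prop) (by fun_prop)]
      simp [real_inner_smul_right, inner_sum, real_inner_comm]
    · simp [h0]

/-- A remainder `√N · o(u)` vanishes when `u = O_P(N^(-1/2))`: `‖r‖ ≥ η` forces `u ≥ δ` or `u ≥
η/(ε√N)`, of probability at most `C/(Nδ²)` and `Cε²/η²`. Small `ε` handles the second bound, then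
large `N` the first. -/
theorem tendstoInMeasure_zero_of_le_sqrt_mul {E : Type*} [SeminormedAddCommGroup E]
    {u : ℕ → Ω → ℝ} {r : ℕ → Ω → E} {C : ℝ}
    (hu : ∀ N : ℕ, 0 < N → ∀ ε, 0 < ε → P.real {ω | ε ≤ u N ω} ≤ C / (N * ε ^ 2))
    (hr : ∀ ε, 0 < ε → ∃ δ, 0 < δ ∧ ∀ N : ℕ, 0 < N → ∀ᵐ ω ∂P, u N ω < δ →
      ‖r N ω‖ ≤ ε * (√N * u N ω)) :
    TendstoInMeasure P r atTop 0 := by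
  rw [tendstoInMeasure_iff_measureReal_norm]
  intro η hη
  simp only [Pi.zero_apply, sub_zero]
  have hC : 0 ≤ C := by
    have := measureReal_nonneg.trans (hu 1 one_pos 1 one_pos)
    simpa using this
  rw [Metric.tendsto_atTop]
  intro ρ hρ
  obtain ⟨ε, hε, hερ⟩ : ∃ ε : ℝ, 0 < ε ∧ C * ε ^ 2 / η ^ 2 < ρ / 2 := by
    have h : Tendsto (fun ε : ℝ => C * ε ^ 2 / η ^ 2) (𝓝[>] 0) (𝓝 0) := by
      have : ContinuousAt (fun ε : ℝ => C * ε ^ 2 / η ^ 2) 0 := by fun_prop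
      simpa using this.tendsto.mono_left nhdsWithin_le_nhds
    obtain ⟨ε, h1, h2⟩ := ((h.eventually (gt_mem_nhds (half_pos hρ))).and
      self_mem_nhdsWithin).exists
    exact ⟨ε, h2, h1⟩
  obtain ⟨δ, hδ, hrδ⟩ := hr ε hε
  have h : Tendsto (fun N : ℕ => C / (N * δ ^ 2)) atTop (𝓝 0) := by
    refine Tendsto.const_div_atTop ?_ C
    exact tendsto_natCast_atTop_atTop.atTop_mul_const (by positivity)
  obtain ⟨N₀, hN₀⟩ := eventually_atTop.1 ((h.eventually (gt_mem_nhds (half_pos hρ))).and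
    (eventually_gt_atTop 0))
  refine ⟨N₀, fun N hN => ?_⟩
  obtain ⟨h1, h2⟩ := hN₀ N hN
  have hN' : (0 : ℝ) < N := Nat.cast_pos.2 h2
  have hs : 0 < √(N : ℝ) := Real.sqrt_pos.2 hN'
  rw [Real.dist_eq, sub_zero, abs_of_nonneg measureReal_nonneg]
  have hsub : P.real {ω | η ≤ ‖r N ω‖} ≤
      P.real ({ω | δ ≤ u N ω} ∪ {ω | η / (ε * √N) ≤ u N ω}) := by
    refine ENNReal.toReal_mono (measure_ne_top _ _) (measure_mono_ae ?_)
    filter_upwards [hrδ N h2] with ω hω hη'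
    by_cases hc : δ ≤ u N ω
    · exact Or.inl hc
    · refine Or.inr ?_
      change η / (ε * √N) ≤ u N ω
      rw [div_le_iff₀ (by positivity)]
      exact (le_trans hη' (hω (not_le.1 hc))).trans (le_of_eq (by ring))
  refine hsub.trans_lt ((measureReal_union_le _ _).trans_lt ?_)
  have h3 := hu N h2 δ hδ
  have h4 := hu N h2 (η / (ε * √N)) (by positivity)
  have h5 : C / (N * (η / (ε * √N)) ^ 2) = C * ε ^ 2 / η ^ 2 := by
    rw [div_pow, mul_pow, Real.sq_sqrt hN'.le]
    field_simp
  rw [h5] at h4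
  linarith

end VectorCentralLimit

/-! ### Fluctuations of the empirical cell frequencies. -/

namespace StepStressDesign

variable {R L : ℕ} (D : StepStressDesign L) (a : StepStressParam R)

/-- The vector of cell indicators of a unit with latent lifetimes `t`. -/
noncomputable def cellIndicator (t : Fin R → ℝ) (c : StepStressCell R L) : ℝ :=
  {t : Fin R → ℝ | D.InCell t c}.indicator 1 t

theorem empProb_eq (t : ℕ → Fin R → ℝ) (N : ℕ) (c : StepStressCell R L) :
    D.empProb t N c = (∑ n ∈ Finset.range N, D.cellIndicator (t n) c) / N := by
  classical
  rw [empProb, cellCount, Finset.natCast_card_filter]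
  congr 1

theorem cellIndicator_of_inCell {t : Fin R → ℝ} {c : StepStressCell R L} (h : D.InCell t c) :
    D.cellIndicator t = Pi.single c 1 := by
  ext c'
  rcases eq_or_ne c' c with rfl | hne
  · rw [Pi.single_eq_same]
    exact Set.indicator_of_mem (s := {t : Fin R → ℝ | D.InCell t c'}) h 1
  · rw [Pi.single_eq_of_ne hne]
    exact Set.indicator_of_notMem (s := {t : Fin R → ℝ | D.InCell t c'})
      (fun h' => hne (InCell.unique h' h)) 1

/-- At most one indicator is nonzero, so cross terms vanish and second moments reduce to means. -/
theorem sum_mul_cellIndicator_sq (t : Fin R → ℝ) (g : StepStressCell R L → ℝ) :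
    (∑ c, g c * D.cellIndicator t c) ^ 2 = ∑ c, g c ^ 2 * D.cellIndicator t c := by
  by_cases h : ∃ c, D.InCell t c
  · obtain ⟨c, hc⟩ := h
    simp [D.cellIndicator_of_inCell hc, Pi.single_apply, - Fintype.sum_option]
  · have : ∀ c, D.cellIndicator t c = 0 := fun c =>
      Set.indicator_of_notMem (s := {t : Fin R → ℝ | D.InCell t c}) (fun h' => h ⟨c, h'⟩) 1
    simp [this]

theorem measurable_cellIndicator (c : StepStressCell R L) :
    Measurable fun t : Fin R → ℝ => D.cellIndicator t c :=
  measurable_one.indicator (D.measurableSet_inCell c)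

theorem norm_cellIndicator_le (t : Fin R → ℝ) (c : StepStressCell R L) :
    ‖D.cellIndicator t c‖ ≤ 1 := by
  by_cases h : D.InCell t c
  · rw [D.cellIndicator_of_inCell h]; simp
  · have : D.cellIndicator t c = 0 :=
      Set.indicator_of_notMem (s := {t : Fin R → ℝ | D.InCell t c}) h 1
    simp [this]

section Sampling

variable {Ω : Type*} [MeasurableSpace Ω] {P : Measure Ω} [IsProbabilityMeasure P]
  {T : ℕ → Fin R → Ω → ℝ}

theorem map_lifetimes (hT : ∀ n j, Measurable (T n j))
    (hindep : iIndepFun (fun (s : ℕ × Fin R) => T s.1 s.2) P)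
    (hlaw : ∀ n j t, P.real {ω | T n j ω ≤ t} = D.lifetimeCDF a j t) (n : ℕ) :
    P.map (fun ω j => T n j ω) = Measure.pi fun j => P.map (T 0 j) := by
  have hi : iIndepFun (T n) P :=
    hindep.precomp (g := fun j => (n, j)) (Prod.mk_right_injective n)
  rw [hi.map_fun_eq_pi_map fun j => (hT n j).aemeasurable]
  congr with j : 1
  refine Measure.ext_of_Iic _ _ fun t => ?_
  rw [Measure.map_apply (hT n j) measurableSet_Iic, Measure.map_apply (hT 0 j) measurableSet_Iic,
    ← ofReal_measureReal, ← ofReal_measureReal]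
  exact congrArg _ ((hlaw n j t).trans (hlaw 0 j t).symm)

omit [IsProbabilityMeasure P] in
theorem map_lifetime_Iic (hT : ∀ n j, Measurable (T n j))
    (hlaw : ∀ n j t, P.real {ω | T n j ω ≤ t} = D.lifetimeCDF a j t) (j : Fin R) (t : ℝ) :
    (P.map (T 0 j)).real (Set.Iic t) = D.lifetimeCDF a j t := by
  rw [map_measureReal_apply (hT 0 j) measurableSet_Iic]
  exact hlaw 0 j t

variable (hT : ∀ n j, Measurable (T n j))
  (hindep : iIndepFun (fun (s : ℕ × Fin R) => T s.1 s.2) P)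
  (hlaw : ∀ n j t, P.real {ω | T n j ω ≤ t} = D.lifetimeCDF a j t)

include hT hindep hlaw

theorem integral_cellIndicator (n : ℕ) (c : StepStressCell R L) :
    ∫ ω, D.cellIndicator (fun j => T n j ω) c ∂P = D.cellProb a c := by
  have : ∀ j, IsProbabilityMeasure (P.map (T 0 j)) :=
    fun j => Measure.isProbabilityMeasure_map (hT 0 j).aemeasurable
  rw [← D.pi_inCell a (D.map_lifetime_Iic a hT hlaw) c, ← D.map_lifetimes a hT hindep hlaw n,
    ← integral_indicator_one (D.measurableSet_inCell c), integral_map (by fun_prop)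
    (measurable_one.indicator (D.measurableSet_inCell c)).aestronglyMeasurable]
  rfl

theorem ae_exists_inCell_lifetimes (n : ℕ) : ∀ᵐ ω ∂P, ∃ c, D.InCell (fun j => T n j ω) c := by
  have : ∀ j, IsProbabilityMeasure (P.map (T 0 j)) :=
    fun j => Measure.isProbabilityMeasure_map (hT 0 j).aemeasurable
  have h := D.ae_exists_inCell a (D.map_lifetime_Iic a hT hlaw)
  rw [← D.map_lifetimes a hT hindep hlaw n] at h
  exact ae_of_ae_map (f := fun ω j => T n j ω) (by fun_prop) h

theorem ae_sum_empProb {N : ℕ} (hN : 0 < N) :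
    ∀ᵐ ω ∂P, ∑ c, D.empProb (fun n j => T n j ω) N c = 1 := by
  filter_upwards [ae_all_iff.2 fun n => D.ae_exists_inCell_lifetimes a hT hindep hlaw n] with ω hω
  have h1 : ∀ n, ∑ c, D.cellIndicator (fun j => T n j ω) c = 1 := by
    intro n
    obtain ⟨c, hc⟩ := hω n
    simp [D.cellIndicator_of_inCell hc, Pi.single_apply, - Fintype.sum_option]
  simp only [empProb_eq, ← Finset.sum_div]
  rw [Finset.sum_comm]
  simp only [h1, Finset.sum_const, Finset.card_range, nsmul_eq_mul, mul_one]
  exact div_self (Nat.cast_pos.2 hN).ne'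

omit hindep hlaw in
theorem measurable_cellIndicator_lifetimes (n : ℕ) (c : StepStressCell R L) :
    Measurable fun ω => D.cellIndicator (fun j => T n j ω) c :=
  (D.measurable_cellIndicator c).comp (measurable_pi_lambda _ fun j => hT n j)

omit hindep hlaw in
theorem memLp_cellIndicator (n : ℕ) (c : StepStressCell R L) (p : ENNReal) :
    MemLp (fun ω => D.cellIndicator (fun j => T n j ω) c) p P :=
  MemLp.of_bound (D.measurable_cellIndicator_lifetimes hT n c).aestronglyMeasurable 1
    (Eventually.of_forall fun _ => D.norm_cellIndicator_le _ c)

theorem integral_sum_mul_cellIndicator (n : ℕ) (g : StepStressCell R L → ℝ) :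
    ∫ ω, ∑ c, g c * D.cellIndicator (fun j => T n j ω) c ∂P = ∑ c, D.cellProb a c * g c := by
  rw [integral_finsetSum _ fun c _ =>
    ((D.memLp_cellIndicator hT n c 1).integrable le_rfl).const_mul _]
  refine Finset.sum_congr rfl fun c _ => ?_
  rw [integral_const_mul, D.integral_cellIndicator a hT hindep hlaw, mul_comm]

theorem variance_sum_mul_cellIndicator (n : ℕ) (g : StepStressCell R L → ℝ) :
    Var[fun ω => ∑ c, g c * D.cellIndicator (fun j => T n j ω) c; P] =
      ∑ c, D.cellProb a c * g c ^ 2 - (∑ c, D.cellProb a c * g c) ^ 2 := by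
  rw [variance_eq_sub (memLp_finsetSum _ fun c _ =>
    (D.memLp_cellIndicator hT n c 2).const_mul _)]
  simp only [Pi.pow_apply, sum_mul_cellIndicator_sq]
  rw [D.integral_sum_mul_cellIndicator a hT hindep hlaw,
    D.integral_sum_mul_cellIndicator a hT hindep hlaw]

theorem variance_cellIndicator_le (n : ℕ) (c : StepStressCell R L) :
    Var[fun ω => D.cellIndicator (fun j => T n j ω) c; P] ≤ 1 := by
  have h := D.variance_sum_mul_cellIndicator a hT hindep hlaw n (Pi.single c 1)
  simp only [Pi.single_apply, ite_mul, one_mul, zero_mul, Finset.sum_ite_eq', Finset.mem_univ,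
    if_true, ite_pow, one_pow, mul_ite, mul_one, mul_zero, ne_eq, OfNat.ofNat_ne_zero,
    not_false_eq_true, zero_pow] at h
  rw [h]
  have h1 : D.cellProb a c ≤ 1 := by
    rw [← D.sum_cellProb a]
    exact Finset.single_le_sum (f := D.cellProb a) (fun c _ => (D.cellProb_pos a c).le)
      (Finset.mem_univ c)
  nlinarith [sq_nonneg (D.cellProb a c)]

/-- Chebyshev in each cell, with indicator variances at most 1, and a union bound over the cells. -/
theorem measureReal_norm_empProb_sub_ge {N : ℕ} (hN : 0 < N) {ε : ℝ} (hε : 0 < ε) :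
    P.real {ω | ε ≤ ‖D.empProb (fun n j => T n j ω) N - D.cellProb a‖} ≤
      Fintype.card (StepStressCell R L) / (N * ε ^ 2) := by
  have hN' : (0 : ℝ) < N := Nat.cast_pos.2 hN
  have hsub : {ω | ε ≤ ‖D.empProb (fun n j => T n j ω) N - D.cellProb a‖} ⊆
      ⋃ c, {ω | ε ≤ |D.empProb (fun n j => T n j ω) N c - D.cellProb a c|} := by
    intro ω hω
    by_contra hcon
    simp only [Set.mem_iUnion, Set.mem_ofPred_eq, not_exists, not_le] at hcon
    exact absurd ((pi_norm_lt_iff hε).2 hcon) (not_lt.2 hω)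
  have hvec : iIndepFun (fun n ω j => T n j ω) P := hindep.curry hT
  have hone : ∀ c, P.real {ω | ε ≤ |D.empProb (fun n j => T n j ω) N c - D.cellProb a c|} ≤
      1 / (N * ε ^ 2) := by
    intro c
    set X : ℕ → Ω → ℝ := fun n ω => D.cellIndicator (fun j => T n j ω) c with hXdef
    have hX : ∀ n, MemLp (X n) 2 P := fun n => D.memLp_cellIndicator hT n c 2
    have hmean : P[∑ n ∈ Finset.range N, X n] = N * D.cellProb a c := by
      simp only [Finset.sum_apply]
      rw [integral_finsetSum _ fun n _ => (hX n).integrable one_le_two]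
      simp [hXdef, D.integral_cellIndicator a hT hindep hlaw]
    have hvar : Var[∑ n ∈ Finset.range N, X n; P] ≤ N := by
      rw [IndepFun.variance_sum (fun n _ => hX n) fun n _ m _ hnm =>
        (hvec.indepFun hnm).comp (D.measurable_cellIndicator c) (D.measurable_cellIndicator c)]
      refine (Finset.sum_le_sum fun n _ =>
        D.variance_cellIndicator_le a hT hindep hlaw n c).trans ?_
      simp
    have hch := meas_ge_le_variance_div_sq (memLp_finsetSum' (Finset.range N) fun n _ => hX n)
      (mul_pos hN' hε)
    rw [hmean] at hch
    have hset : {ω | ε ≤ |D.empProb (fun n j => T n j ω) N c - D.cellProb a c|} =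
        {ω | N * ε ≤ |(∑ n ∈ Finset.range N, X n) ω - N * D.cellProb a c|} := by
      ext ω
      simp only [Set.mem_ofPred_eq]
      have e : (∑ n ∈ Finset.range N, X n) ω - N * D.cellProb a c =
          N * (D.empProb (fun n j => T n j ω) N c - D.cellProb a c) := by
        rw [empProb_eq, Finset.sum_apply, mul_sub, mul_div_cancel₀ _ hN'.ne']
      rw [e, abs_mul, abs_of_pos hN', mul_le_mul_iff_right₀ hN']
    rw [hset]
    refine (ENNReal.toReal_le_of_le_ofReal
      (div_nonneg (variance_nonneg _ _) (sq_nonneg _)) hch).trans ?_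
    rw [div_le_div_iff₀ (by positivity) (by positivity)]
    nlinarith [mul_le_mul_of_nonneg_right hvar (by positivity : 0 ≤ N * ε ^ 2)]
  calc _ ≤ P.real (⋃ c, {ω | ε ≤ |D.empProb (fun n j => T n j ω) N c - D.cellProb a c|}) :=
        measureReal_mono hsub
    _ ≤ ∑ c, P.real {ω | ε ≤ |D.empProb (fun n j => T n j ω) N c - D.cellProb a c|} :=
        measureReal_iUnion_fintype_le _
    _ ≤ ∑ _c : StepStressCell R L, 1 / (N * ε ^ 2) := Finset.sum_le_sum fun c _ => hone c
    _ = _ := by rw [Finset.sum_const, nsmul_eq_mul, Finset.card_univ, mul_one_div]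

/-- Asymptotic normality of the linear part of the estimator. -/
theorem tendstoInDistribution_influenceMatrix (β : ℝ) :
    TendstoInDistribution (fun (N : ℕ) ω => √(N : ℝ) • (WithLp.toLp 2 (D.influenceMatrix a β *ᵥ
        (D.empProb (fun n j => T n j ω) N - D.cellProb a)) : StepStressParam R)) atTop
      (id : StepStressParam R → StepStressParam R) (fun _ => P)
      (multivariateGaussian 0 (D.asympCov β a)) := by
  set M := D.influenceMatrix a β
  set φ : (Fin R → ℝ) → StepStressParam R := fun t =>
    WithLp.toLp 2 (M *ᵥ (D.cellIndicator t - D.cellProb a)) with hφ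
  have hφm : Measurable φ := by
    refine (PiLp.continuous_toLp 2 _).measurable.comp
      (M.mulVecLin.toContinuousLinearMap.continuous.measurable.comp
        (Measurable.sub_const (measurable_pi_lambda _ fun c => D.measurable_cellIndicator c) _))
  have hvec : iIndepFun (fun n ω j => T n j ω) P := hindep.curry hT
  set X : ℕ → Ω → StepStressParam R := fun n ω => φ fun j => T n j ω with hX
  have hXm : ∀ n, Measurable (X n) := fun n =>
    hφm.comp (measurable_pi_lambda _ fun j => hT n j)
  have hinner : ∀ (t : StepStressParam R) ω, inner ℝ t (X 0 ω) =
      ∑ c, (t.ofLp ᵥ* M) c * D.cellIndicator (fun j => T 0 j ω) c -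
        ∑ c, D.cellProb a c * (t.ofLp ᵥ* M) c := by
    intro t ω
    have : inner ℝ t (X 0 ω) = t.ofLp ⬝ᵥ (M *ᵥ
        (D.cellIndicator (fun j => T 0 j ω) - D.cellProb a)) := by
      rw [EuclideanSpace.inner_eq_star_dotProduct, star_trivial, dotProduct_comm]
    rw [this, dotProduct_mulVec, dotProduct_sub]
    congr 1
    exact dotProduct_comm _ _
  have hint : ∀ t : StepStressParam R, Integrable (fun ω =>
      ∑ c, (t.ofLp ᵥ* M) c * D.cellIndicator (fun j => T 0 j ω) c) P := fun t =>
    integrable_finsetSum _ fun c _ =>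
      ((D.memLp_cellIndicator hT 0 c 1).integrable le_rfl).const_mul _
  have key := tendstoInDistribution_multivariateGaussian hXm (hvec.comp (fun _ => φ) fun _ => hφm)
    (fun n => IdentDistrib.comp (f := fun ω j => T n j ω) (g := fun ω j => T 0 j ω) (u := φ) ⟨(measurable_pi_lambda _ fun j => hT n j).aemeasurable,
      (measurable_pi_lambda _ fun j => hT 0 j).aemeasurable, by
      rw [D.map_lifetimes a hT hindep hlaw, D.map_lifetimes a hT hindep hlaw]⟩ hφm)
    ?_ (D.posSemidef_asympCov a β) ?_ ?_
  · refine key.congr (fun N => Eventually.of_forall fun ω => ?_) EventuallyEq.rfl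
    -- At `N = 0` the frequencies are the default `0/0 = 0`, but the factor `√0` makes both sides
    -- vanish.
    rcases N.eq_zero_or_pos with rfl | hN
    · simp
    have hN' : (0 : ℝ) < N := Nat.cast_pos.2 hN
    have e : ∑ n ∈ Finset.range N, X n ω = (N : ℝ) • (WithLp.toLp 2 (M *ᵥ
        (D.empProb (fun n j => T n j ω) N - D.cellProb a)) : StepStressParam R) := by
      simp only [hX, hφ]
      rw [← WithLp.toLp_sum, ← mulVec_sum, ← WithLp.toLp_smul, ← mulVec_smul]
      congr 2
      ext c
      simp only [Finset.sum_apply, Pi.sub_apply, Pi.smul_apply, smul_eq_mul, empProb_eq,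
        Finset.sum_sub_distrib, Finset.sum_const, Finset.card_range, nsmul_eq_mul]
      rw [mul_sub, mul_div_cancel₀ _ hN'.ne']
    simp only [e, smul_smul]
    congr 1
    rw [inv_mul_eq_div, Real.div_sqrt]
  · set A : (StepStressCell R L → ℝ) →L[ℝ] StepStressParam R :=
      (EuclideanSpace.equiv _ ℝ).symm.toContinuousLinearMap.comp
        M.mulVecLin.toContinuousLinearMap
    refine MemLp.of_bound (hXm 0).aestronglyMeasurable (‖A‖ * (1 + ‖D.cellProb a‖))
      (Eventually.of_forall fun ω => A.le_opNorm_of_le ((norm_sub_le _ _).trans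
        (add_le_add_left ?_ _)))
    exact (pi_norm_le_iff_of_nonneg zero_le_one).2 fun c => D.norm_cellIndicator_le _ c
  · intro t
    simp only [hinner]
    rw [integral_sub (hint t) (integrable_const _),
      D.integral_sum_mul_cellIndicator a hT hindep hlaw]
    simp
  · intro t
    simp only [hinner]
    rw [variance_sub_const (hint t).aestronglyMeasurable,
      D.variance_sum_mul_cellIndicator a hT hindep hlaw, D.dotProduct_asympCov_mulVec]

end Sampling

end StepStressDesign

/-! ### Existence and asymptotic normality of the estimator. -/

theorem theorem1 {R L : ℕ} (D : StepStressDesign L) (β : ℝ) (hβ : 0 ≤ β)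
    (a₀ : StepStressParam R)
    {Ω : Type*} [MeasurableSpace Ω] (P : Measure Ω) [IsProbabilityMeasure P]
    -- `T n j` is the lifetime of unit `n` attributed to cause `j`
    (T : ℕ → Fin R → Ω → ℝ) (hT : ∀ n j, Measurable (T n j))
    (hindep : iIndepFun (fun (s : ℕ × Fin R) => T s.1 s.2) P)
    (hlaw : ∀ n j t, P.real {ω | T n j ω ≤ t} = D.lifetimeCDF a₀ j t)
    -- `est N` is the minimum density power divergence estimator based on the first `N` units
    (est : ℕ → Ω → StepStressParam R) (hest : ∀ N, AEMeasurable (est N) P)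
    (hmin : ∀ N, ∀ᵐ ω ∂P,
      (∃ b, IsMinDPD D β (D.empProb (fun n j => T n j ω) N) b) →
        IsMinDPD D β (D.empProb (fun n j => T n j ω) N) (est N ω)) :
    Tendsto (fun N => P.real {ω | ∃ b, IsMinDPD D β (D.empProb (fun n j => T n j ω) N) b})
      atTop (𝓝 1) ∧
    IsUnit (D.matJ β a₀).det ∧
    (D.asympCov β a₀).PosSemidef ∧
    TendstoInDistribution (fun (N : ℕ) ω => √(N : ℝ) • (est N ω - a₀)) atTop
      (id : StepStressParam R → StepStressParam R) (fun _ => P)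
      (multivariateGaussian 0 (D.asympCov β a₀)) := by
  have hJ : IsUnit (D.matJ β a₀).det := (isUnit_iff_isUnit_det _).1 (D.posDef_matJ a₀ β).isUnit
  have hcont : Continuous (D.cellProb (R := R)) :=
    continuous_pi fun c => (D.contDiff_cellProb c (n := 1)).continuous
  have hex := eventually_exists_min_densityPowerDiv hβ (fun a => D.cellProb_pos a)
    (fun a => D.sum_cellProb a) hcont (D.comap_cellProb_le_nhds a₀)
  obtain ⟨δ₀, hδ₀, hex⟩ := Metric.eventually_nhds_iff.1 hex
  set u : ℕ → Ω → ℝ := fun N ω => ‖D.empProb (fun n j => T n j ω) N - D.cellProb a₀‖ with hu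
  have hub : ∀ N : ℕ, 0 < N → ∀ ε, 0 < ε →
      P.real {ω | ε ≤ u N ω} ≤ Fintype.card (StepStressCell R L) / (N * ε ^ 2) :=
    fun N hN ε hε => D.measureReal_norm_empProb_sub_ge a₀ hT hindep hlaw hN hε
  have hexists : ∀ N : ℕ, 0 < N → ∀ᵐ ω ∂P, u N ω < δ₀ →
      ∃ b, IsMinDPD D β (D.empProb (fun n j => T n j ω) N) b := by
    intro N hN
    filter_upwards [D.ae_sum_empProb a₀ hT hindep hlaw hN] with ω hω hlt
    exact hex (by rwa [dist_eq_norm]) hω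
  refine ⟨?_, hJ, D.posSemidef_asympCov a₀ β, ?_⟩
  · have hlow : Tendsto (fun N : ℕ => 1 - Fintype.card (StepStressCell R L) / (N * δ₀ ^ 2))
        atTop (𝓝 (1 - 0)) :=
      (Tendsto.const_div_atTop (tendsto_natCast_atTop_atTop.atTop_mul_const (by positivity))
        _).const_sub 1
    rw [sub_zero] at hlow
    refine tendsto_of_tendsto_of_tendsto_of_le_of_le' hlow tendsto_const_nhds ?_
      (Eventually.of_forall fun N => measureReal_le_one)
    filter_upwards [eventually_gt_atTop 0] with N hN
    -- Subadditivity is used instead of complements, so the existence event need not be shown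
    -- measurable.
    have h1 : (1 : ℝ) ≤ P.real ({ω | ∃ b, IsMinDPD D β (D.empProb (fun n j => T n j ω) N) b} ∪
        {ω | δ₀ ≤ u N ω}) := by
      rw [← probReal_univ (μ := P)]
      refine ENNReal.toReal_mono (measure_ne_top _ _) (measure_mono_ae ?_)
      filter_upwards [hexists N hN] with ω hω _
      by_cases hc : δ₀ ≤ u N ω
      · exact Or.inr hc
      · exact Or.inl (hω (not_le.1 hc))
    have h2 := h1.trans (measureReal_union_le _ _)
    linarith [hub N hN δ₀ hδ₀]
  · have hlin := isLittleO_min_densityPowerDiv (a₀ := a₀) (W := D.jacobian) hβ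
      (fun a => D.cellProb_pos a) (fun a => D.sum_cellProb a) (fun c => D.contDiff_cellProb c)
      (D.comap_cellProb_le_nhds a₀) (fun _ _ _ => rfl) rfl hJ
    have hlin' := ((EuclideanSpace.equiv (Fin R × Fin 2) ℝ).symm.toContinuousLinearMap.isBigO_comp
      _ _).trans_isLittleO hlin
    -- Slutsky: the linear part carries the limit law, and the difference is `√N` times the `o(‖q -
    -- p‖)` remainder, available almost surely where `q` is close enough for a minimizer to exist.
    refine tendstoInDistribution_of_tendstoInMeasure_sub _ _
      (D.tendstoInDistribution_influenceMatrix a₀ hT hindep hlaw β) ?_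
      fun N => by have := hest N; fun_prop
    refine tendstoInMeasure_zero_of_le_sqrt_mul hub fun ε hε => ?_
    have h1 := hlin'.def hε
    rw [eventually_inf_principal, eventually_comap] at h1
    obtain ⟨δ, hδ, h1⟩ := Metric.eventually_nhds_iff.1 h1
    refine ⟨min δ δ₀, lt_min hδ hδ₀, fun N hN => ?_⟩
    filter_upwards [hexists N hN, hmin N, D.ae_sum_empProb a₀ hT hindep hlaw hN]
      with ω h2 h3 h4 h5
    have h6 := h1 (y := D.empProb (fun n j => T n j ω) N)
      (by rw [dist_eq_norm]; exact h5.trans_le (min_le_left _ _)) (_, est N ω) rfl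
      ⟨h4, h3 (h2 (h5.trans_le (min_le_right _ _)))⟩
    simp only [Pi.sub_apply, ← smul_sub]
    rw [norm_smul, Real.norm_of_nonneg (Real.sqrt_nonneg _), mul_left_comm]
    exact mul_le_mul_of_nonneg_left h6 (Real.sqrt_nonneg _)
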